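/- **Setting.** Fix integers $q\ge 2$, $p\ge 1$ and a $q$-periodic Jacobi operator on $\mathbb Z$, $(H^0y)_n=a^0_{n-1}y_{n-1}+a^0_ny_{n+1}+b^0_ny_n$, with real $a^0_n=a^0_{n+q}>0$, $b^0_n=b^0_{n+q}$, $\prod_{j=1}^q a^0_j=1$. Let $\vartheta_n(\lambda),\varphi_n(\lambda)$ be the solutions of $H^0y=\lambda y$ with $\vartheta_0=\varphi_1=1$, $\vartheta_1=\varphi_0=0$, and put $\Delta=\frac12(\varphi_{q+1}+\vartheta_q)$, $\phi=\frac12(\varphi_{q+1}-\vartheta_q)$. The band edges $\lambda_k^\pm$ are the zeros of $\Delta^2-1$; all gaps are assumed open, i.e. these zeros are simple. The Dirichlet eigenvalues $\mu_j$ are the zeros of $\varphi_q$. Let $\Lambda=\{(\lambda,\Omega):\Omega^2=1-\Delta^2(\lambda)\}$ be the two-sheeted Riemann surface of $\Omega=\sqrt{1-\Delta^2}$, with physical sheet $\Lambda_1=\{|\Delta+i\Omega|<1\}$ and second sheet $\Lambda_2=\{|\Delta+i\Omega|>1\}$. Orders of zeros and poles on $\Lambda$ are taken in a local parameter of $\Lambda$.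 On $\Lambda$ put $m_\pm=(\phi\pm i\Omega)/\varphi_q$ and $\psi_n^\pm=\vartheta_n+m_\pm\varphi_n$. For $\nu\in\{2p-1,2p\}$ let $\mathcal V_\nu$ be the set of real $(u_n,v_n)_{0\le n\le p}$ (extended by $0$ to $n\in\mathbb Z$) with $a_n:=a_n^0+u_n>0$, $v_0\ne0$, and $u_p\neq 0$ if $\nu=2p$, respectively $u_p=0$, $v_p\ne0$ if $\nu=2p-1$. Let $b_n:=b^0_n+v_n$, and let $H$ be the Jacobi operator with coefficients $a_n,b_n$. Let $f^\pm$ and $\varphi^+$ be the solutions of $Hy=\lambda y$ with $f^-_n=\psi^-_n$ for $n\le 0$, and $f^+_n=\psi_n^+$, $\varphi^+_n=\varphi_n$ for $n\ge p+1$. With $\{f,g\}=a_n(f_ng_{n+1}-f_{n+1}g_n)$ put $w=\{f^-,f^+\}$, $s=\{f^+,\overline{f^-}\}$ (on the bands, continued to $\Lambda$ by exchanging the sheets in $f^-$), and $$\hat w=\frac{\varphi_q}{a_0^0}\,w,\qquad \alpha=\frac{\hat w}{2i\Omega},\qquad R_-=\frac sw .$$ $A$ is the real polynomial with $A(\lambda)=\operatorname{Re}\alpha(\lambda+i0)-1$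 on the bands. Bound states (resonances) of $H$ are the zeros of $\hat w$ on $\Lambda_1$ (on $\Lambda_2$). Finally $c_1=1/\prod_{n=0}^pa_n$, $c_3=c_1c_2$, with $c_2=c_1u_p(a_p^0+a_p)$ if $\nu=2p$ and $c_2=c_1(a_p^0)^2v_p$ if $\nu=2p-1$. **Theorem 1.3.** Consider perturbations $(u,v)\in\mathcal V_{2p-1}\cup\mathcal V_{2p}$ such that $\hat w$ and $R_-+1$ have only simple zeros on $\Lambda$, no zero of $\hat w$ lies over a band edge $\lambda_k^\pm$, and no zero of $\hat w$ or of $R_-+1$ lies over a Dirichlet eigenvalue $\mu_j$. (At a band edge that is not a Dirichlet eigenvalue, $R_-+1=2i\Omega f_0^+/\hat w$ always has a zero, due to the factor $\Omega$; its simplicity means that $f_0^+$ does not vanish there.) Then the pair of functions $(\hat w,f_0^+)$ on $\Lambda$ is uniquely determined by the bound states and resonances of $H$, the set of zeros of $R_-+1$, the polynomials $A$ and $\varphi_0^+$, and the constants $c_3$ and $v_0$: if two such perturbations of the same $H^0$ have the same bound states, the same resonances, the same set of zeros of $R_-+1$, and the same $A$, $\varphi_0^+$, $c_3$, $v_0$,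 then they have the same $\hat w$ and the same $f_0^+$. -/

import Mathlib

/-!
Finitely supported perturbations of periodic Jacobi operators on `ℤ`: fundamental solutions,
the two-sheeted Riemann surface of `√(1 - Δ²)`, Jost solutions, scattering quantities.
-/

noncomputable section

namespace JacobiScattering

/-! ### Solutions of three-term recurrences -/

section Recurrence

variable {R : Type*} [CommRing R] [Algebra ℝ R]

/-- The pair `(y (m + k), y (m + k + 1))` for the solution of
`a (n-1) y (n-1) + a n y (n+1) + b n y n = x y n` with `y m = c₀`, `y (m+1) = c₁`. -/
def solFwd (a b : ℤ → ℝ) (x : R) (m : ℤ) (c₀ c₁ : R) : ℕ → R × R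
  | 0 => (c₀, c₁)
  | k + 1 =>
    let y := solFwd a b x m c₀ c₁ k
    (y.2, (a (m + k + 1))⁻¹ •
      ((x - algebraMap ℝ R (b (m + k + 1))) * y.2 - a (m + k) • y.1))

/-- The pair `(y (m - k), y (m - k + 1))` for the same solution. -/
def solBwd (a b : ℤ → ℝ) (x : R) (m : ℤ) (c₀ c₁ : R) : ℕ → R × R
  | 0 => (c₀, c₁)
  | k + 1 =>
    let y := solBwd a b x m c₀ c₁ k
    ((a (m - k - 1))⁻¹ • ((x - algebraMap ℝ R (b (m - k))) * y.1 - a (m - k) • y.2), y.1)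

/-- The solution `y : ℤ → R` of `a (n-1) y (n-1) + a n y (n+1) + b n y n = x y n` with
`y m = c₀`, `y (m+1) = c₁` (all `a n` being non-zero). The spectral parameter `x` may be a complex
number, or the variable of a polynomial ring. -/
def jacobiSol (a b : ℤ → ℝ) (x : R) (m : ℤ) (c₀ c₁ : R) (n : ℤ) : R :=
  if m ≤ n then (solFwd a b x m c₀ c₁ (n - m).toNat).1
  else (solBwd a b x m c₀ c₁ (m - n).toNat).1

theorem jacobiSol_start (a b : ℤ → ℝ) (x : R) (m : ℤ) (c₀ c₁ : R) :
    jacobiSol a b x m c₀ c₁ m = c₀ := by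
  simp [jacobiSol, solFwd]

theorem jacobiSol_next (a b : ℤ → ℝ) (x : R) (m : ℤ) (c₀ c₁ : R) :
    jacobiSol a b x m c₀ c₁ (m + 1) = c₁ := by
  simp [jacobiSol, solFwd]

theorem jacobiSol_add (a b : ℤ → ℝ) (x : R) (m : ℤ) (c₀ c₁ : R) (k : ℕ) :
    solFwd a b x m c₀ c₁ k =
      (jacobiSol a b x m c₀ c₁ (m + k), jacobiSol a b x m c₀ c₁ (m + k + 1)) := by
  have h1 : (m + (k : ℤ) + 1 - m).toNat = k + 1 := by omega
  have h2 : m ≤ m + (k : ℤ) + 1 := by omega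
  simp only [jacobiSol, if_pos h2, h1]
  simp [solFwd]

theorem jacobiSol_sub (a b : ℤ → ℝ) (x : R) (m : ℤ) (c₀ c₁ : R) (k : ℕ) :
    solBwd a b x m c₀ c₁ k =
      (jacobiSol a b x m c₀ c₁ (m - k), jacobiSol a b x m c₀ c₁ (m - k + 1)) := by
  cases k with
  | zero => simp [solBwd, jacobiSol_start, jacobiSol_next]
  | succ k =>
    have h1 : (m - (m - ((k + 1 : ℕ) : ℤ))).toNat = k + 1 := by omega
    have h2 : ¬ m ≤ m - ((k + 1 : ℕ) : ℤ) := by omega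
    have h3 : m - ((k + 1 : ℕ) : ℤ) + 1 = m - k := by push_cast; ring
    rw [h3]
    refine Prod.ext ?_ ?_
    · simp only [jacobiSol, if_neg h2, h1]
    · cases k with
      | zero => simp [solBwd, jacobiSol_start]
      | succ j =>
        have h4 : (m - (m - ((j + 1 : ℕ) : ℤ))).toNat = j + 1 := by omega
        have h5 : ¬ m ≤ m - ((j + 1 : ℕ) : ℤ) := by omega
        simp only [jacobiSol, if_neg h5, h4]
        rfl

/-- `jacobiSol` solves the Jacobi equation on all of `ℤ`. -/
theorem jacobiSol_rec (a b : ℤ → ℝ) (ha : ∀ n, a n ≠ 0) (x : R) (m : ℤ) (c₀ c₁ : R) (n : ℤ) :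
    a (n - 1) • jacobiSol a b x m c₀ c₁ (n - 1) + a n • jacobiSol a b x m c₀ c₁ (n + 1)
      + b n • jacobiSol a b x m c₀ c₁ n = x * jacobiSol a b x m c₀ c₁ n := by
  rcases le_or_gt (m + 1) n with h | h
  · obtain ⟨k, rfl⟩ : ∃ k : ℕ, n = m + k + 1 := ⟨(n - m - 1).toNat, by omega⟩
    have e := congrArg Prod.snd (jacobiSol_add a b x m c₀ c₁ (k + 1))
    rw [solFwd, jacobiSol_add] at e
    simp only at e
    have e2 : m + ((k + 1 : ℕ) : ℤ) + 1 = m + k + 1 + 1 := by push_cast; ring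
    rw [e2] at e
    rw [← e, smul_smul, mul_inv_cancel₀ (ha _), one_smul, show m + (k : ℤ) + 1 - 1 = m + k by ring,
      Algebra.smul_def (b _)]
    ring
  · obtain ⟨k, rfl⟩ : ∃ k : ℕ, n = m - k := ⟨(m - n).toNat, by omega⟩
    have e := congrArg Prod.fst (jacobiSol_sub a b x m c₀ c₁ (k + 1))
    rw [solBwd, jacobiSol_sub] at e
    simp only at e
    have e2 : m - ((k + 1 : ℕ) : ℤ) = m - k - 1 := by push_cast; ring
    rw [e2] at e
    rw [← e, smul_smul, mul_inv_cancel₀ (ha _), one_smul, Algebra.smul_def (b _)]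
    ring

end Recurrence

/-! ### The periodic operator -/

/-- Coefficients of a `q`-periodic Jacobi operator `H⁰`,
`(H⁰ y) n = a (n-1) y (n-1) + a n y (n+1) + b n y n`. -/
structure PeriodicJacobi (q : ℕ) where
  /-- off-diagonal coefficients `a⁰` -/
  a : ℤ → ℝ
  /-- diagonal coefficients `b⁰` -/
  b : ℤ → ℝ
  a_pos : ∀ n, 0 < a n
  a_periodic : ∀ n, a (n + q) = a n
  b_periodic : ∀ n, b (n + q) = b n
  prod_a : ∏ j ∈ Finset.Icc 1 q, a (j : ℤ) = 1

namespace PeriodicJacobi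

variable {q : ℕ} (H₀ : PeriodicJacobi q)

/-- Fundamental solution `ϑ n` (polynomial in `λ`), `ϑ 0 = 1`, `ϑ 1 = 0`. -/
def theta (n : ℤ) : Polynomial ℝ := jacobiSol H₀.a H₀.b Polynomial.X 0 1 0 n

/-- Fundamental solution `φ n` (polynomial in `λ`), `φ 0 = 0`, `φ 1 = 1`. -/
def phi (n : ℤ) : Polynomial ℝ := jacobiSol H₀.a H₀.b Polynomial.X 0 0 1 n

/-- The Lyapunov function `Δ = (φ (q+1) + ϑ q) / 2`. -/
def lyapunov : Polynomial ℝ := Polynomial.C (1 / 2) * (H₀.phi (q + 1) + H₀.theta q)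

/-- The polynomial `(φ (q+1) - ϑ q) / 2`. -/
def phiHalf : Polynomial ℝ := Polynomial.C (1 / 2) * (H₀.phi (q + 1) - H₀.theta q)

/-- The value `Δ(λ)` at a complex number. -/
def disc (l : ℂ) : ℂ := Polynomial.aeval l H₀.lyapunov

/-- All gaps are open: the zeros of `1 - Δ²` (the `2q` band edges) are all simple. -/
def AllGapsOpen : Prop :=
  ∀ l : ℂ, H₀.disc l ^ 2 = 1 → Polynomial.aeval l (Polynomial.derivative H₀.lyapunov) ≠ 0

/-- The two-sheeted Riemann surface `Λ` of `Ω = √(1 - Δ²)`: its points are `P = (λ, Ω)`, with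
`P.1` the projection to `ℂ` and `P.2` the value of `Ω`. It is smooth when all gaps are open. -/
def surface : Set (ℂ × ℂ) := {P | P.2 ^ 2 = 1 - H₀.disc P.1 ^ 2}

/-- The physical sheet `Λ₁`. On `Λ` one has `(Δ + iΩ)(Δ - iΩ) = 1`, and `|Δ + iΩ| = 1` exactly over
the bands; `Λ₁` is the sheet over the cut plane on which `Δ + iΩ = e^{iqϰ}` has modulus less
than one (the sheet with `Ω(λ + i0) < 0` on the last band). -/
def sheet₁ : Set (ℂ × ℂ) :=
  {P | P ∈ H₀.surface ∧ ‖H₀.disc P.1 + Complex.I * P.2‖ < 1}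

/-- The non-physical sheet `Λ₂`. -/
def sheet₂ : Set (ℂ × ℂ) :=
  {P | P ∈ H₀.surface ∧ 1 < ‖H₀.disc P.1 + Complex.I * P.2‖}

/-- The points of `Λ` over the band edges `λ_k^±`, i.e. the branch points. -/
def edgePoints : Set (ℂ × ℂ) := {P | P ∈ H₀.surface ∧ P.2 = 0}

/-- The points of `Λ` over the Dirichlet eigenvalues `μ_j`, the zeros of `φ q`. -/
def dirichletPoints : Set (ℂ × ℂ) :=
  {P | P ∈ H₀.surface ∧ Polynomial.aeval P.1 (H₀.phi q) = 0}

/-- A local parametrization of `Λ` near its point `P`, sending `t = 0` to `P`. Away from the branch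
points `t = λ - λ(P)`. At a branch point `t² = D (λ - λ(P))`, where `D ≠ 0` is the derivative of
`1 - Δ²` there, so that `Ω = t √((1 - Δ²) / t²)`, the argument of the root being close to `1`. -/
def chart (P : ℂ × ℂ) (t : ℂ) : ℂ × ℂ :=
  if P.2 = 0 then
    let D : ℂ := -2 * H₀.disc P.1 * Polynomial.aeval P.1 (Polynomial.derivative H₀.lyapunov)
    let l : ℂ := P.1 + t ^ 2 / D
    (l, t * ((1 - H₀.disc l ^ 2) / t ^ 2) ^ (1 / 2 : ℂ))
  else
    (P.1 + t, P.2 * ((1 - H₀.disc (P.1 + t) ^ 2) / P.2 ^ 2) ^ (1 / 2 : ℂ))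

theorem chart_zero {P : ℂ × ℂ} (hP : P ∈ H₀.surface) : H₀.chart P 0 = P := by
  have hP' : P.2 ^ 2 = 1 - H₀.disc P.1 ^ 2 := hP
  unfold chart
  split_ifs with h
  · ext <;> simp [h]
  · ext
    · simp
    · simp [← hP', h]

theorem chart_mem {P : ℂ × ℂ} (hP : P ∈ H₀.surface) (t : ℂ) : H₀.chart P t ∈ H₀.surface := by
  by_cases ht : t = 0
  · rw [ht, H₀.chart_zero hP]; exact hP
  have hs : ∀ z : ℂ, (z ^ (1 / 2 : ℂ)) ^ 2 = z := fun z => by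
    rw [← Complex.cpow_nat_mul]; simp
  unfold chart surface
  split_ifs with h
  · simp only [Set.mem_ofPred_eq, mul_pow, hs]
    field_simp
  · simp only [Set.mem_ofPred_eq, mul_pow, hs]
    field_simp

/-- The order at `P ∈ Λ` of a meromorphic function on `Λ`, in the local parameter (negative at
poles). It does not depend on the value which the formula for `F` takes at `P` itself. -/
def ordAt (F : ℂ × ℂ → ℂ) (P : ℂ × ℂ) : WithTop ℤ :=
  meromorphicOrderAt (fun t => F (H₀.chart P t)) 0

/-- The set of zeros on `Λ` of a meromorphic function. -/
def zeroSet (F : ℂ × ℂ → ℂ) : Set (ℂ × ℂ) := {P | P ∈ H₀.surface ∧ 0 < H₀.ordAt F P}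

/-- All zeros on `Λ` are simple. -/
def OnlySimpleZeros (F : ℂ × ℂ → ℂ) : Prop := ∀ P ∈ H₀.zeroSet F, H₀.ordAt F P = 1

/-- The Titchmarsh-Weyl function `m₊` on `Λ`. -/
def mPlus (P : ℂ × ℂ) : ℂ :=
  (Polynomial.aeval P.1 H₀.phiHalf + Complex.I * P.2) / Polynomial.aeval P.1 (H₀.phi q)

/-- The Titchmarsh-Weyl function `m₋` on `Λ`. -/
def mMinus (P : ℂ × ℂ) : ℂ :=
  (Polynomial.aeval P.1 H₀.phiHalf - Complex.I * P.2) / Polynomial.aeval P.1 (H₀.phi q)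

/-- The Bloch function `ψ⁺ n = ϑ n + m₊ φ n`. -/
def psiPlus (n : ℤ) (P : ℂ × ℂ) : ℂ :=
  Polynomial.aeval P.1 (H₀.theta n) + H₀.mPlus P * Polynomial.aeval P.1 (H₀.phi n)

/-- The Bloch function `ψ⁻ n = ϑ n + m₋ φ n`. -/
def psiMinus (n : ℤ) (P : ℂ × ℂ) : ℂ :=
  Polynomial.aeval P.1 (H₀.theta n) + H₀.mMinus P * Polynomial.aeval P.1 (H₀.phi n)

end PeriodicJacobi

/-! ### The perturbed operator -/

/-- A perturbation `(u, v)`, extended by zero to sequences on `ℤ`. -/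
structure Perturbation where
  /-- off-diagonal perturbation -/
  u : ℤ → ℝ
  /-- diagonal perturbation -/
  v : ℤ → ℝ

namespace Perturbation

variable {q : ℕ} (H₀ : PeriodicJacobi q) (p : ℕ) (V : Perturbation)

/-- The class `𝒱_ν`, `ν ∈ {2p - 1, 2p}`. -/
structure InClass (ν : ℕ) : Prop where
  u_supp : ∀ n : ℤ, n < 0 ∨ (p : ℤ) < n → V.u n = 0
  v_supp : ∀ n : ℤ, n < 0 ∨ (p : ℤ) < n → V.v n = 0
  pos : ∀ n : ℤ, 0 ≤ n → n ≤ p → 0 < H₀.a n + V.u n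
  v_zero_ne : V.v 0 ≠ 0
  last : (ν = 2 * p ∧ V.u p ≠ 0) ∨ (ν + 1 = 2 * p ∧ V.u p = 0 ∧ V.v p ≠ 0)

/-- Off-diagonal coefficients of `H = H⁰ + V`. -/
def a (n : ℤ) : ℝ := H₀.a n + V.u n

/-- Diagonal coefficients of `H = H⁰ + V`. -/
def b (n : ℤ) : ℝ := H₀.b n + V.v n

/-- The constant `c₁ = 1 / ∏_{j=0}^p a j`. -/
def c₁ : ℝ := 1 / ∏ j ∈ Finset.range (p + 1), V.a H₀ (j : ℤ)

/-- The constant `c₂`, for a perturbation of class `𝒱_ν`. -/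
def c₂ (ν : ℕ) : ℝ :=
  if ν = 2 * p then V.c₁ H₀ p * V.u p * (H₀.a p + V.a H₀ p)
  else V.c₁ H₀ p * H₀.a p ^ 2 * V.v p

/-- The constant `c₃ = c₁ c₂`. -/
def c₃ (ν : ℕ) : ℝ := V.c₁ H₀ p * V.c₂ H₀ p ν

/-- The polynomial solution `φ⁺` of the perturbed equation, `φ⁺ n = φ n` for `n ≥ p + 1`. -/
def phiPlus (n : ℤ) : Polynomial ℝ :=
  jacobiSol (V.a H₀) (V.b H₀) Polynomial.X (p + 1) (H₀.phi (p + 1)) (H₀.phi (p + 2)) n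

/-- The Jost solution `f⁺`: the solution of the perturbed equation with `f⁺ n = ψ⁺ n` for
`n ≥ p + 1`. -/
def jostPlus (n : ℤ) (P : ℂ × ℂ) : ℂ :=
  jacobiSol (V.a H₀) (V.b H₀) P.1 (p + 1) (H₀.psiPlus (p + 1) P) (H₀.psiPlus (p + 2) P) n

/-- The Jost solution `f⁻`: the solution of the perturbed equation with `f⁻ n = ψ⁻ n` for
`n ≤ 0`. -/
def jostMinus (n : ℤ) (P : ℂ × ℂ) : ℂ :=
  jacobiSol (V.a H₀) (V.b H₀) P.1 (-1) (H₀.psiMinus (-1) P) (H₀.psiMinus 0 P) n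

/-- The continuation to `Λ` of the complex conjugate of `f⁻` on the bands. At real `λ` in a band,
`Ω` is real and conjugation changes `Ω` into `-Ω`, i.e. exchanges the sheets. -/
def jostMinusConj (n : ℤ) (P : ℂ × ℂ) : ℂ := V.jostMinus H₀ n (P.1, -P.2)

/-- The Wronskian `w = {f⁻, f⁺}` (independent of the place, here taken at `0`). -/
def w (P : ℂ × ℂ) : ℂ :=
  V.a H₀ 0 * (V.jostMinus H₀ 0 P * V.jostPlus H₀ p 1 P - V.jostMinus H₀ 1 P * V.jostPlus H₀ p 0 P)

/-- The Wronskian `s = {f⁺, conj f⁻}`, continued to `Λ`. -/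
def s (P : ℂ × ℂ) : ℂ :=
  V.a H₀ 0 *
    (V.jostPlus H₀ p 0 P * V.jostMinusConj H₀ 1 P - V.jostPlus H₀ p 1 P * V.jostMinusConj H₀ 0 P)

/-- The function `ŵ = φ_q w / a⁰_0` on `Λ` (it extends analytically to the Dirichlet points). -/
def wHat (P : ℂ × ℂ) : ℂ := Polynomial.aeval P.1 (H₀.phi q) / H₀.a 0 * V.w H₀ p P

/-- The inverse transmission coefficient `α = 1 / T = ŵ / (2 i Ω)`. -/
def alpha (P : ℂ × ℂ) : ℂ := V.wHat H₀ p P / (2 * Complex.I * P.2)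

/-- The reflection coefficient `R₋ = s / w` on `Λ`. -/
def reflMinus (P : ℂ × ℂ) : ℂ := V.s H₀ p P / V.w H₀ p P

/-- The meromorphic function `R₋ + 1` on `Λ`. -/
def reflMinusAddOne (P : ℂ × ℂ) : ℂ := V.reflMinus H₀ p P + 1

/-- The real polynomial `A` is the one with `A(λ) = Re α(λ + i0) - 1` on the spectrum of `H⁰`
(in the interior of the bands; `Re α` has the same value at both points of `Λ` over `λ`). -/
def IsPolyA (A : Polynomial ℝ) : Prop :=
  ∀ l : ℝ, H₀.lyapunov.eval l ^ 2 < 1 → ∀ P ∈ H₀.surface, P.1 = (l : ℂ) →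
    A.eval l = (V.alpha H₀ p P).re - 1

/-- The bound states of `H`: the zeros of `ŵ` on the physical sheet. -/
def boundStates : Set (ℂ × ℂ) := H₀.zeroSet (V.wHat H₀ p) ∩ H₀.sheet₁

/-- The resonances of `H`: the zeros of `ŵ` on the non-physical sheet. -/
def resonances : Set (ℂ × ℂ) := H₀.zeroSet (V.wHat H₀ p) ∩ H₀.sheet₂

/-- The zeros on `Λ` of `ŵ` and of `R₋ + 1` are simple, those of `ŵ` avoid the points over the band
edges and over the Dirichlet eigenvalues, those of `R₋ + 1` avoid the points over the Dirichlet
eigenvalues.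

At a band edge which is not a Dirichlet eigenvalue `R₋ + 1 = 2iΩ f₀⁺ / ŵ` always has a zero, coming
from the factor `Ω`. That this zero is simple (in the local parameter of `Λ`) says that the Jost
function `f₀⁺`, hence `(R₋ + 1) / Ω`, does not vanish at the edge. -/
structure Generic : Prop where
  simple_wHat : H₀.OnlySimpleZeros (V.wHat H₀ p)
  simple_refl : H₀.OnlySimpleZeros (V.reflMinusAddOne H₀ p)
  wHat_edge : Disjoint (H₀.zeroSet (V.wHat H₀ p)) H₀.edgePoints
  wHat_dirichlet : Disjoint (H₀.zeroSet (V.wHat H₀ p)) H₀.dirichletPoints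
  refl_dirichlet : Disjoint (H₀.zeroSet (V.reflMinusAddOne H₀ p)) H₀.dirichletPoints

end Perturbation

end JacobiScattering

end

noncomputable section

namespace JacobiScattering

open Polynomial Filter Topology

/-! ### Solutions of three-term recurrences: uniqueness, linearity, Wronskians -/

section Recurrence

variable {R : Type*} [CommRing R] [Algebra ℝ R]

/-! Write f₀⁺ = ϑ₀⁺ + m₊ φ₀⁺ with polynomials ϑ₀⁺, φ₀⁺, and let * be the exchange of sheets. Since
φ₀⁺ is given, f₀⁺ is known once ϑ₀⁺ is, and ϑ₀⁺ is read off from the polynomial N = φ_q f₀⁺ (f₀⁺)*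
(`normPoly`).

The roots of N come from the divisor of f₀⁺. The identity (R₋ + 1) ŵ = 2iΩ f₀⁺, together with the
absence of common zeros of f₀⁺ and w, shows that away from edges and Dirichlet points the zeros of
f₀⁺ are those of R₋ + 1, all simple. Over a Dirichlet eigenvalue off the edges the order of f₀⁺ is
that of the pole of m₊ φ₀⁺, if any, and over an edge N does not vanish (`normPoly_roots_eq`).

The constant factor of N is fixed at infinity. There f₀⁺ tends to c₁ ∏ a⁰ on the physical sheet, and
N / (√(Δ² - 1) φ₀⁺) tends to twice that limit. The leading term of φ₀⁺ gives c₂, hence c₁ = c₃ / c₂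
is known (`normPoly_eq`).

Completing the square in φ_q N gives ϑ₀⁺ up to a choice of sign, and boundedness of f₀⁺ at infinity
decides it (`thetaPlus_eq`).

Finally a⁰₀ ŵ = E + iΩ O with polynomials E, O. On the bands Re α is O / (2a⁰₀), so A gives O and
with it a₀ φ₁⁺. The Wronskian of ϑ⁺ and φ⁺ then gives a₀ ϑ₁⁺, hence E. The functions are compared
off the Dirichlet points, where m± involve no division by zero. -/

/-- `y` solves `a (n-1) y (n-1) + a n y (n+1) + b n y n = x y n` on `ℤ`. -/
def IsSol (a b : ℤ → ℝ) (x : R) (y : ℤ → R) : Prop :=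
  ∀ n, a (n - 1) • y (n - 1) + a n • y (n + 1) + b n • y n = x * y n

theorem isSol_jacobiSol {a b : ℤ → ℝ} (ha : ∀ n, a n ≠ 0) (x : R) (m : ℤ) (c₀ c₁ : R) :
    IsSol a b x (jacobiSol a b x m c₀ c₁) :=
  jacobiSol_rec a b ha x m c₀ c₁

theorem IsSol.add_mul {a b : ℤ → ℝ} {x : R} {y z : ℤ → R} (hy : IsSol a b x y)
    (hz : IsSol a b x z) (c : R) : IsSol a b x (fun n => y n + c * z n) := by
  intro n
  have h1 := hy n
  have h2 := hz n
  simp only [Algebra.smul_def] at *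
  linear_combination h1 + c * h2

theorem IsSol.const_mul {a b : ℤ → ℝ} {x : R} {y : ℤ → R} (hy : IsSol a b x y) (c : R) :
    IsSol a b x (fun n => c * y n) := by
  intro n
  have h1 := hy n
  simp only [Algebra.smul_def] at *
  linear_combination c * h1

theorem IsSol.map {S : Type*} [CommRing S] [Algebra ℝ S] {a b : ℤ → ℝ} {x : R} {y : ℤ → R}
    (hy : IsSol a b x y) (g : R →ₐ[ℝ] S) : IsSol a b (g x) (fun n => g (y n)) := by
  intro n
  have h1 := congrArg g (hy n)
  simpa using h1

/-- Forward uniqueness, for coefficients which agree to the right of `m`. -/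
theorem IsSol.eq_of_le {a b a' b' : ℤ → ℝ} {x : R} {y z : ℤ → R} {m : ℤ}
    (ha : ∀ n, a n ≠ 0) (haa : ∀ n, m ≤ n → a n = a' n) (hbb : ∀ n, m < n → b n = b' n)
    (hy : IsSol a b x y) (hz : IsSol a' b' x z) (h0 : y m = z m) (h1 : y (m + 1) = z (m + 1))
    {n : ℤ} (hn : m ≤ n) : y n = z n := by
  have key : ∀ k : ℕ, y (m + k) = z (m + k) ∧ y (m + k + 1) = z (m + k + 1) := by
    intro k
    induction k with
    | zero => simpa using ⟨h0, h1⟩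
    | succ k ih =>
      obtain ⟨e0, e1⟩ := ih
      have e : m + ((k + 1 : ℕ) : ℤ) = m + k + 1 := by push_cast; ring
      rw [e]
      refine ⟨e1, ?_⟩
      have hy' := hy (m + k + 1)
      have hz' := hz (m + k + 1)
      rw [← haa _ (by omega), ← haa _ (by omega), ← hbb _ (by omega), ← e1,
        show m + (k : ℤ) + 1 - 1 = m + k by ring, ← e0] at hz'
      rw [show m + (k : ℤ) + 1 - 1 = m + k by ring] at hy'
      have h : a (m + k + 1) • y (m + k + 1 + 1) = a (m + k + 1) • z (m + k + 1 + 1) := by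
        linear_combination hy' - hz'
      have := congrArg (fun t => (a (m + k + 1))⁻¹ • t) h
      simpa [smul_smul, ha] using this
  have := (key (n - m).toNat).1
  rwa [show m + (((n - m).toNat : ℕ) : ℤ) = n by omega] at this

/-- A solution on `ℤ` is determined by two consecutive values. -/
theorem IsSol.unique {a b : ℤ → ℝ} {x : R} {y z : ℤ → R} (m : ℤ)
    (ha : ∀ n, a n ≠ 0) (hy : IsSol a b x y) (hz : IsSol a b x z)
    (h0 : y m = z m) (h1 : y (m + 1) = z (m + 1)) (n : ℤ) : y n = z n := by
  rcases le_total m n with h | h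
  · exact hy.eq_of_le ha (fun _ _ => rfl) (fun _ _ => rfl) hz h0 h1 h
  have key : ∀ k : ℕ, y (m - k) = z (m - k) ∧ y (m - k + 1) = z (m - k + 1) := by
    intro k
    induction k with
    | zero => simpa using ⟨h0, h1⟩
    | succ k ih =>
      obtain ⟨e0, e1⟩ := ih
      have e : m - ((k + 1 : ℕ) : ℤ) = m - k - 1 := by push_cast; ring
      rw [e, sub_add_cancel]
      refine ⟨?_, e0⟩
      have hy' := hy (m - k)
      have hz' := hz (m - k)
      rw [← e1, ← e0] at hz'
      have h : a (m - k - 1) • y (m - k - 1) = a (m - k - 1) • z (m - k - 1) := by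
        linear_combination hy' - hz'
      have := congrArg (fun t => (a (m - k - 1))⁻¹ • t) h
      simpa [smul_smul, ha] using this
  have := (key (m - n).toNat).1
  rwa [show m - (((m - n).toNat : ℕ) : ℤ) = n by omega] at this

/-- The Wronskian of two solutions is constant. -/
theorem IsSol.wronskian_eq {a b : ℤ → ℝ} {x : R} {y z : ℤ → R} (hy : IsSol a b x y)
    (hz : IsSol a b x z) (m n : ℤ) :
    a n • (y n * z (n + 1) - y (n + 1) * z n) = a m • (y m * z (m + 1) - y (m + 1) * z m) := by
  have step : ∀ n : ℤ, a (n - 1) • (y (n - 1) * z n - y n * z (n - 1)) =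
      a n • (y n * z (n + 1) - y (n + 1) * z n) := by
    intro n
    have h1 := hy n
    have h2 := hz n
    simp only [Algebra.smul_def] at *
    linear_combination z n * h1 - y n * h2
  have all : ∀ n : ℤ, a n • (y n * z (n + 1) - y (n + 1) * z n) =
      a 0 • (y 0 * z (0 + 1) - y (0 + 1) * z 0) := by
    intro n
    induction n using Int.induction_on with
    | zero => rfl
    | succ k ih =>
      rw [← ih, ← step]
      simp
    | pred k ih =>
      rw [← ih, ← step (-k)]
      simp
  rw [all n, all m]

theorem map_jacobiSol {S : Type*} [CommRing S] [Algebra ℝ S] {a b : ℤ → ℝ} (ha : ∀ n, a n ≠ 0)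
    (g : R →ₐ[ℝ] S) (x : R) (m : ℤ) (c₀ c₁ : R) (n : ℤ) :
    g (jacobiSol a b x m c₀ c₁ n) = jacobiSol a b (g x) m (g c₀) (g c₁) n :=
  IsSol.unique m ha ((isSol_jacobiSol ha x m c₀ c₁).map g) (isSol_jacobiSol ha _ m _ _)
    (by simp only [jacobiSol_start]) (by simp only [jacobiSol_next]) n

theorem jacobiSol_add_mul {a b : ℤ → ℝ} (ha : ∀ n, a n ≠ 0) (x : R) (m : ℤ)
    (c₀ c₁ d₀ d₁ c : R) (n : ℤ) :
    jacobiSol a b x m (c₀ + c * d₀) (c₁ + c * d₁) n =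
      jacobiSol a b x m c₀ c₁ n + c * jacobiSol a b x m d₀ d₁ n :=
  IsSol.unique m ha (isSol_jacobiSol ha _ m _ _)
    ((isSol_jacobiSol ha x m c₀ c₁).add_mul (isSol_jacobiSol ha x m d₀ d₁) c)
    (by simp only [jacobiSol_start]) (by simp only [jacobiSol_next]) n

end Recurrence

/-! ### The unperturbed operator -/

namespace PeriodicJacobi

variable {q : ℕ} (H₀ : PeriodicJacobi q)

theorem a_ne (n : ℤ) : H₀.a n ≠ 0 := (H₀.a_pos n).ne'

theorem a_period : H₀.a q = H₀.a 0 := by simpa using H₀.a_periodic 0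

theorem isSol_theta : IsSol H₀.a H₀.b X H₀.theta := isSol_jacobiSol H₀.a_ne _ _ _ _

theorem isSol_phi : IsSol H₀.a H₀.b X H₀.phi := isSol_jacobiSol H₀.a_ne _ _ _ _

@[simp] theorem theta_zero : H₀.theta 0 = 1 := jacobiSol_start ..
@[simp] theorem theta_one : H₀.theta 1 = 0 := by
  simpa [theta] using jacobiSol_next H₀.a H₀.b (X : ℝ[X]) 0 1 0
@[simp] theorem phi_zero : H₀.phi 0 = 0 := jacobiSol_start ..
@[simp] theorem phi_one : H₀.phi 1 = 1 := by
  simpa [phi] using jacobiSol_next H₀.a H₀.b (X : ℝ[X]) 0 0 1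

theorem wronskian_theta_phi (n : ℤ) :
    H₀.a n • (H₀.theta n * H₀.phi (n + 1) - H₀.theta (n + 1) * H₀.phi n) = C (H₀.a 0) := by
  rw [H₀.isSol_theta.wronskian_eq H₀.isSol_phi 0 n]
  simp [smul_eq_C_mul]

/-- The monodromy matrix has determinant one. -/
theorem det_monodromy :
    H₀.theta q * H₀.phi (q + 1) - H₀.theta (q + 1) * H₀.phi q = 1 := by
  have h := H₀.wronskian_theta_phi q
  rw [a_period, smul_eq_C_mul] at h
  have h0 : (C (H₀.a 0) : ℝ[X]) ≠ 0 := by simpa using H₀.a_ne 0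
  exact mul_left_cancel₀ h0 (by rw [h, mul_one])

/-- The difference of the two squares is -ϑ_q φ_{q+1}, and the monodromy matrix has determinant one.
On Λ this reads m₊ m₋ = -ϑ_{q+1} / φ_q where φ_q ≠ 0. -/
theorem phiHalf_sq_add :
    H₀.phiHalf ^ 2 + 1 - H₀.lyapunov ^ 2 = -(H₀.phi q * H₀.theta (q + 1)) := by
  have h := H₀.det_monodromy
  have h2 : (C (1 / 2) : ℝ[X]) * 2 = 1 := by
    rw [← C_ofNat, ← C_mul]; norm_num
  simp only [phiHalf, lyapunov]
  linear_combination (-1 : ℝ[X]) * h - (H₀.theta q * H₀.phi (q + 1)) * (C (1 / 2) * 2 + 1) * h2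

variable {A : Type*} [CommRing A] [Algebra ℝ A]

theorem aeval_phiHalf_sq_add (x : A) :
    aeval x H₀.phiHalf ^ 2 + 1 - aeval x H₀.lyapunov ^ 2 =
      -(aeval x (H₀.phi q) * aeval x (H₀.theta (q + 1))) := by
  simpa using congrArg (aeval x) H₀.phiHalf_sq_add

theorem lyapunov_add_phiHalf : H₀.lyapunov + H₀.phiHalf = H₀.phi (q + 1) := by
  have h2 : (C (1 / 2) : ℝ[X]) * 2 = 1 := by
    rw [← C_ofNat, ← C_mul]; norm_num
  simp only [phiHalf, lyapunov]
  linear_combination H₀.phi (q + 1) * h2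

theorem lyapunov_sub_phiHalf : H₀.lyapunov - H₀.phiHalf = H₀.theta q := by
  have h2 : (C (1 / 2) : ℝ[X]) * 2 = 1 := by
    rw [← C_ofNat, ← C_mul]; norm_num
  simp only [phiHalf, lyapunov]
  linear_combination H₀.theta q * h2

end PeriodicJacobi

/-! ### The perturbed operator -/

namespace Perturbation

variable {q : ℕ} (H₀ : PeriodicJacobi q) (p : ℕ) (V : Perturbation)

/-- The polynomial solution `ϑ⁺` of the perturbed equation, `ϑ⁺ n = ϑ n` for `n ≥ p + 1`. -/
def thetaPlus (n : ℤ) : ℝ[X] :=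
  jacobiSol (V.a H₀) (V.b H₀) X (p + 1) (H₀.theta (p + 1)) (H₀.theta (p + 2)) n

variable {H₀ p V} {ν : ℕ}

theorem InClass.a_pos (hV : V.InClass H₀ p ν) (n : ℤ) : 0 < V.a H₀ n := by
  by_cases h : 0 ≤ n ∧ n ≤ p
  · exact hV.pos n h.1 h.2
  · have : V.u n = 0 := hV.u_supp n (by omega)
    simpa [Perturbation.a, this] using H₀.a_pos n

theorem InClass.a_ne (hV : V.InClass H₀ p ν) (n : ℤ) : V.a H₀ n ≠ 0 := (hV.a_pos n).ne'

theorem InClass.a_eq (hV : V.InClass H₀ p ν) {n : ℤ} (h : n < 0 ∨ (p : ℤ) < n) :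
    V.a H₀ n = H₀.a n := by
  simp [Perturbation.a, hV.u_supp n h]

theorem InClass.b_eq (hV : V.InClass H₀ p ν) {n : ℤ} (h : n < 0 ∨ (p : ℤ) < n) :
    V.b H₀ n = H₀.b n := by
  simp [Perturbation.b, hV.v_supp n h]

theorem InClass.isSol_thetaPlus (hV : V.InClass H₀ p ν) :
    IsSol (V.a H₀) (V.b H₀) X (V.thetaPlus H₀ p) := isSol_jacobiSol hV.a_ne _ _ _ _

theorem InClass.isSol_phiPlus (hV : V.InClass H₀ p ν) :
    IsSol (V.a H₀) (V.b H₀) X (V.phiPlus H₀ p) := isSol_jacobiSol hV.a_ne _ _ _ _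

theorem thetaPlus_start : V.thetaPlus H₀ p (p + 1) = H₀.theta (p + 1) := jacobiSol_start ..
theorem thetaPlus_next : V.thetaPlus H₀ p (p + 1 + 1) = H₀.theta (p + 1 + 1) := by
  rw [thetaPlus, jacobiSol_next]; rw [add_assoc]; rfl
theorem phiPlus_start : V.phiPlus H₀ p (p + 1) = H₀.phi (p + 1) := jacobiSol_start ..
theorem phiPlus_next : V.phiPlus H₀ p (p + 1 + 1) = H₀.phi (p + 1 + 1) := by
  rw [phiPlus, jacobiSol_next]; rw [add_assoc]; rfl

theorem InClass.thetaPlus_eq (hV : V.InClass H₀ p ν) {n : ℤ} (hn : (p : ℤ) + 1 ≤ n) :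
    V.thetaPlus H₀ p n = H₀.theta n :=
  hV.isSol_thetaPlus.eq_of_le hV.a_ne (fun n h => hV.a_eq (by omega))
    (fun n h => hV.b_eq (by omega)) H₀.isSol_theta thetaPlus_start thetaPlus_next hn

theorem InClass.phiPlus_eq (hV : V.InClass H₀ p ν) {n : ℤ} (hn : (p : ℤ) + 1 ≤ n) :
    V.phiPlus H₀ p n = H₀.phi n :=
  hV.isSol_phiPlus.eq_of_le hV.a_ne (fun n h => hV.a_eq (by omega))
    (fun n h => hV.b_eq (by omega)) H₀.isSol_phi phiPlus_start phiPlus_next hn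

theorem InClass.wronskian_plus (hV : V.InClass H₀ p ν) :
    C (V.a H₀ 0) * (V.thetaPlus H₀ p 0 * V.phiPlus H₀ p 1 -
      V.thetaPlus H₀ p 1 * V.phiPlus H₀ p 0) = C (H₀.a 0) := by
  have h := hV.isSol_thetaPlus.wronskian_eq hV.isSol_phiPlus (p + 1) 0
  rw [thetaPlus_start, thetaPlus_next, phiPlus_start, phiPlus_next, hV.a_eq (n := (p : ℤ) + 1) (by omega),
    H₀.wronskian_theta_phi] at h
  simpa [smul_eq_C_mul] using h

theorem InClass.jostPlus_eq (hV : V.InClass H₀ p ν) (n : ℤ) (P : ℂ × ℂ) :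
    V.jostPlus H₀ p n P = aeval P.1 (V.thetaPlus H₀ p n) +
      H₀.mPlus P * aeval P.1 (V.phiPlus H₀ p n) := by
  simp only [jostPlus, PeriodicJacobi.psiPlus, thetaPlus, phiPlus, jacobiSol_add_mul hV.a_ne,
    map_jacobiSol hV.a_ne, aeval_X]

theorem InClass.jostMinus_zero (P : ℂ × ℂ) : V.jostMinus H₀ 0 P = 1 := by
  have := jacobiSol_next (V.a H₀) (V.b H₀) P.1 (-1) (H₀.psiMinus (-1) P) (H₀.psiMinus 0 P)
  rw [show (-1 : ℤ) + 1 = 0 by ring] at this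
  rw [jostMinus, this]
  simp [PeriodicJacobi.psiMinus]

/-- Subtract the equations of H and H⁰ at n = 0. The two solutions agree at -1 and 0, where f₀⁻ = 1,
and a₋₁ = a⁰₋₁, so only the terms at 1 and v₀ survive. -/
theorem InClass.jostMinus_one (hV : V.InClass H₀ p ν) (P : ℂ × ℂ) :
    V.a H₀ 0 * V.jostMinus H₀ 1 P = H₀.a 0 * H₀.mMinus P - V.v 0 := by
  have h := isSol_jacobiSol (b := V.b H₀) hV.a_ne P.1 (-1) (H₀.psiMinus (-1) P) (H₀.psiMinus 0 P) 0
  have h0 : V.jostMinus H₀ 0 P = 1 := InClass.jostMinus_zero P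
  have hs := jacobiSol_start (V.a H₀) (V.b H₀) P.1 (-1) (H₀.psiMinus (-1) P) (H₀.psiMinus 0 P)
  have h2 : IsSol H₀.a H₀.b P.1 (fun n => H₀.psiMinus n P) := by
    have := (H₀.isSol_theta.map (aeval P.1)).add_mul (H₀.isSol_phi.map (aeval P.1)) (H₀.mMinus P)
    simpa [PeriodicJacobi.psiMinus] using this
  have h2 := h2 0
  change _ + V.a H₀ 0 • V.jostMinus H₀ 1 P + V.b H₀ 0 • V.jostMinus H₀ 0 P
    = P.1 * V.jostMinus H₀ 0 P at h
  rw [h0] at h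
  simp only [zero_sub, zero_add] at h h2
  rw [hs, hV.a_eq (by omega)] at h
  have e0 : H₀.psiMinus 0 P = 1 := by simp [PeriodicJacobi.psiMinus]
  have e1 : H₀.psiMinus 1 P = H₀.mMinus P := by simp [PeriodicJacobi.psiMinus]
  rw [e0, e1] at h2
  simp only [Complex.real_smul, Perturbation.b, Complex.ofReal_add] at h h2
  linear_combination h - h2

theorem InClass.w_eq (hV : V.InClass H₀ p ν) (P : ℂ × ℂ) :
    V.w H₀ p P = V.a H₀ 0 * V.jostPlus H₀ p 1 P -
      (H₀.a 0 * H₀.mMinus P - V.v 0) * V.jostPlus H₀ p 0 P := by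
  rw [← hV.jostMinus_one, w, InClass.jostMinus_zero]
  ring

/-- Since f₀⁻ and its conjugate are both 1, the terms with f₁⁺ cancel. The rest is a⁰₀ (m₊ - m₋)
f₀⁺, and m₊ - m₋ = 2iΩ / φ_q. -/
theorem InClass.s_add_w (hV : V.InClass H₀ p ν) (P : ℂ × ℂ) :
    V.s H₀ p P + V.w H₀ p P =
      H₀.a 0 * (2 * Complex.I * P.2 / aeval P.1 (H₀.phi q)) * V.jostPlus H₀ p 0 P := by
  have h := hV.jostMinus_one (P.1, -P.2)
  rw [hV.w_eq, s, jostMinusConj, jostMinusConj, InClass.jostMinus_zero]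
  rw [PeriodicJacobi.mMinus] at *
  linear_combination V.jostPlus H₀ p 0 P * h

/-- `R₋ + 1 = 2 i Ω f₀⁺ / ŵ`. -/
theorem InClass.reflMinusAddOne_mul (hV : V.InClass H₀ p ν) {P : ℂ × ℂ}
    (h : V.wHat H₀ p P ≠ 0) :
    V.reflMinusAddOne H₀ p P * V.wHat H₀ p P = 2 * Complex.I * P.2 * V.jostPlus H₀ p 0 P := by
  have hw : V.w H₀ p P ≠ 0 := fun h' => h (by simp [wHat, h'])
  have hφ : aeval P.1 (H₀.phi q) ≠ 0 := fun h' => h (by simp [wHat, h'])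
  have ha : (H₀.a 0 : ℂ) ≠ 0 := by exact_mod_cast H₀.a_ne 0
  have e := hV.s_add_w P
  have : V.reflMinusAddOne H₀ p P = (V.s H₀ p P + V.w H₀ p P) / V.w H₀ p P := by
    rw [reflMinusAddOne, reflMinus, add_div, div_self hw]
  rw [this, e, wHat]
  field_simp

/-- `f₀⁺` and `w` have no common zeros. -/
theorem InClass.w_ne_zero (hV : V.InClass H₀ p ν) {P : ℂ × ℂ} (h : V.jostPlus H₀ p 0 P = 0) :
    V.w H₀ p P ≠ 0 := by
  intro hw
  -- At a zero of f₀⁺ one has w = a₀ f₁⁺. A common zero would make f⁺ vanish at 0 and 1,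
  -- contradicting the non-zero Wronskian of ϑ⁺ and φ⁺.
  rw [hV.w_eq, h, mul_zero, sub_zero] at hw
  have ha : (V.a H₀ 0 : ℂ) ≠ 0 := by exact_mod_cast hV.a_ne 0
  have h1 := (mul_eq_zero.1 hw).resolve_left ha
  rw [hV.jostPlus_eq] at h h1
  have hW := congrArg (aeval P.1) hV.wronskian_plus
  simp only [map_mul, map_sub, aeval_C] at hW
  have : (algebraMap ℝ ℂ (H₀.a 0)) = 0 := by
    rw [← hW]
    linear_combination algebraMap ℝ ℂ (V.a H₀ 0) *
      (aeval P.1 (V.phiPlus H₀ p 1) * h - aeval P.1 (V.phiPlus H₀ p 0) * h1)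
  exact H₀.a_ne 0 (by simpa using this)

/-! ### Even and odd parts of ŵ, and the norm of f₀⁺. -/

variable (H₀ p V) in
/-- The even part of `a⁰₀ ŵ` with respect to the exchange of sheets. -/
def wEven : ℝ[X] :=
  C (V.a H₀ 0) * (H₀.phi q * V.thetaPlus H₀ p 1 + H₀.phiHalf * V.phiPlus H₀ p 1) +
    C (V.v 0) * (H₀.phi q * V.thetaPlus H₀ p 0 + H₀.phiHalf * V.phiPlus H₀ p 0) -
    C (H₀.a 0) * (H₀.phiHalf * V.thetaPlus H₀ p 0 - H₀.theta (q + 1) * V.phiPlus H₀ p 0)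

variable (H₀ p V) in
/-- The odd part of `a⁰₀ ŵ`, divided by `iΩ`. -/
def wOdd : ℝ[X] :=
  C (V.a H₀ 0) * V.phiPlus H₀ p 1 + C (V.v 0) * V.phiPlus H₀ p 0 +
    C (H₀.a 0) * V.thetaPlus H₀ p 0

/-- The product m₋ m₊ in φ_q w has φ_q² in the denominator, but its numerator φ² + Ω² is divisible
by φ_q. Hence ŵ has no poles in the finite part of Λ. -/
theorem InClass.wHat_eq (hV : V.InClass H₀ p ν) {P : ℂ × ℂ} (hP : P ∈ H₀.surface)
    (hφ : aeval P.1 (H₀.phi q) ≠ 0) :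
    V.wHat H₀ p P = (aeval P.1 (V.wEven H₀ p) + Complex.I * P.2 * aeval P.1 (V.wOdd H₀ p)) /
      H₀.a 0 := by
  have hP' : P.2 ^ 2 = 1 - (aeval P.1 H₀.lyapunov) ^ 2 := hP
  have hd := H₀.aeval_phiHalf_sq_add P.1
  have ha : (H₀.a 0 : ℂ) ≠ 0 := by exact_mod_cast H₀.a_ne 0
  rw [wHat, hV.w_eq, hV.jostPlus_eq, hV.jostPlus_eq, PeriodicJacobi.mPlus, PeriodicJacobi.mMinus]
  simp only [wEven, wOdd, map_add, map_sub, map_mul, aeval_C, Complex.coe_algebraMap]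
  field_simp
  linear_combination (-(H₀.a 0 : ℂ) * aeval P.1 (V.phiPlus H₀ p 0)) * (hP' + hd) +
    (H₀.a 0 : ℂ) * aeval P.1 (V.phiPlus H₀ p 0) * P.2 ^ 2 * Complex.I_sq

variable (H₀ p V) in
/-- The polynomial `φ_q f₀⁺ (f₀⁺)*`, where `*` is the exchange of sheets. -/
def normPoly : ℝ[X] :=
  H₀.phi q * V.thetaPlus H₀ p 0 ^ 2 + 2 * H₀.phiHalf * V.thetaPlus H₀ p 0 * V.phiPlus H₀ p 0 -
    H₀.theta (q + 1) * V.phiPlus H₀ p 0 ^ 2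

/-- The field is general because the identity is used over ℂ with r = iΩ and over ℝ with r = √(Δ² -
1). -/
theorem aeval_normPoly {K : Type*} [Field K] [Algebra ℝ K] {x r : K}
    (hr : r ^ 2 = aeval x H₀.lyapunov ^ 2 - 1) (hφ : aeval x (H₀.phi q) ≠ 0) :
    aeval x (V.normPoly H₀ p) = aeval x (H₀.phi q) *
      (aeval x (V.thetaPlus H₀ p 0) +
        (aeval x H₀.phiHalf + r) / aeval x (H₀.phi q) * aeval x (V.phiPlus H₀ p 0)) *
      (aeval x (V.thetaPlus H₀ p 0) +
        (aeval x H₀.phiHalf - r) / aeval x (H₀.phi q) * aeval x (V.phiPlus H₀ p 0)) := by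
  have hd := H₀.aeval_phiHalf_sq_add x
  simp only [normPoly, map_add, map_sub, map_mul, map_pow, map_ofNat]
  field_simp
  linear_combination (aeval x (V.phiPlus H₀ p 0)) ^ 2 * (-hd + hr)

theorem InClass.aeval_normPoly_eq (hV : V.InClass H₀ p ν) {P : ℂ × ℂ} (hP : P ∈ H₀.surface)
    (hφ : aeval P.1 (H₀.phi q) ≠ 0) :
    aeval P.1 (V.normPoly H₀ p) = aeval P.1 (H₀.phi q) * V.jostPlus H₀ p 0 P *
      V.jostPlus H₀ p 0 (P.1, -P.2) := by
  have hP' : P.2 ^ 2 = 1 - (aeval P.1 H₀.lyapunov) ^ 2 := hP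
  rw [aeval_normPoly (r := Complex.I * P.2) (by rw [mul_pow, Complex.I_sq, hP']; ring) hφ,
    hV.jostPlus_eq, hV.jostPlus_eq, PeriodicJacobi.mPlus, PeriodicJacobi.mPlus]
  simp only [mul_neg, ← sub_eq_add_neg]

end Perturbation

/-! ### Growth of solutions for large real spectral parameter -/

theorem tendsto_div_pow_succ {y : ℝ → ℝ} {k : ℕ} {A : ℝ}
    (h : Tendsto (fun l => y l / l ^ k) atTop (𝓝 A)) :
    Tendsto (fun l => y l / l ^ (k + 1)) atTop (𝓝 0) := by
  have := h.mul tendsto_inv_atTop_zero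
  rw [mul_zero] at this
  refine this.congr fun l => ?_
  rw [pow_succ, div_eq_mul_inv, div_eq_mul_inv, mul_inv, mul_assoc]

theorem tendsto_div_pow_of_lt {y : ℝ → ℝ} {k j : ℕ} {A : ℝ}
    (h : Tendsto (fun l => y l / l ^ k) atTop (𝓝 A)) (hkj : k < j) :
    Tendsto (fun l => y l / l ^ j) atTop (𝓝 0) := by
  induction j, hkj using Nat.le_induction with
  | base => exact tendsto_div_pow_succ h
  | succ j _ ih => exact tendsto_div_pow_succ ih

/-- At order λ^(k+1) only λ y₁ contributes, so a step of the recurrence multiplies the leading term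
by λ / c. -/
theorem tendsto_div_pow_step {y₀ y₁ y₂ : ℝ → ℝ} {k : ℕ} {A β γ c : ℝ} (hc : c ≠ 0)
    (h₁ : Tendsto (fun l => y₁ l / l ^ k) atTop (𝓝 A))
    (h₀ : Tendsto (fun l => y₀ l / l ^ (k + 1)) atTop (𝓝 0))
    (h : ∀ l, c * y₂ l = (l - β) * y₁ l - γ * y₀ l) :
    Tendsto (fun l => y₂ l / l ^ (k + 1)) atTop (𝓝 (A / c)) := by
  have e := ((h₁.sub ((tendsto_div_pow_succ h₁).const_mul β)).sub (h₀.const_mul γ)).div_const c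
  simp only [mul_zero, sub_zero] at e
  refine e.congr' ?_
  filter_upwards [eventually_ne_atTop 0] with l hl
  rw [div_eq_iff hc]
  have : y₂ l / l ^ (k + 1) * c = (c * y₂ l) / l ^ (k + 1) := by ring
  rw [this, h, pow_succ]
  field_simp

variable {a b : ℤ → ℝ} {y : ℤ → ℝ → ℝ}

theorem tendsto_sol_forward (ha : ∀ n, a n ≠ 0) (hy : ∀ l, IsSol a b l (fun n => y n l))
    {n : ℤ} {k : ℕ} {A : ℝ} (h₁ : Tendsto (fun l => y n l / l ^ k) atTop (𝓝 A))
    (h₀ : Tendsto (fun l => y (n - 1) l / l ^ (k + 1)) atTop (𝓝 0)) (j : ℕ) :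
    Tendsto (fun l => y (n + j) l / l ^ (k + j)) atTop
      (𝓝 (A / ∏ i ∈ Finset.range j, a (n + i))) ∧
    Tendsto (fun l => y (n + j - 1) l / l ^ (k + j + 1)) atTop (𝓝 0) := by
  induction j with
  | zero => simpa using ⟨h₁, h₀⟩
  | succ j ih =>
    obtain ⟨i1, i0⟩ := ih
    constructor
    · rw [Finset.prod_range_succ, ← div_div]
      refine tendsto_div_pow_step (ha (n + j)) i1 i0
        (β := b (n + j)) (γ := a (n + j - 1)) fun l => ?_
      have := hy l (n + j)
      simp only [smul_eq_mul] at this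
      push_cast
      rw [← add_assoc]
      linear_combination this
    · rw [show n + ((j + 1 : ℕ) : ℤ) - 1 = n + j by push_cast; ring]
      exact tendsto_div_pow_of_lt i1 (by omega)

theorem tendsto_sol_backward (ha : ∀ n, a n ≠ 0) (hy : ∀ l, IsSol a b l (fun n => y n l))
    {n : ℤ} {k : ℕ} {A : ℝ} (h₁ : Tendsto (fun l => y n l / l ^ k) atTop (𝓝 A))
    (h₀ : Tendsto (fun l => y (n + 1) l / l ^ (k + 1)) atTop (𝓝 0)) (j : ℕ) :
    Tendsto (fun l => y (n - j) l / l ^ (k + j)) atTop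
      (𝓝 (A / ∏ i ∈ Finset.range j, a (n - 1 - i))) ∧
    Tendsto (fun l => y (n - j + 1) l / l ^ (k + j + 1)) atTop (𝓝 0) := by
  induction j with
  | zero => simpa using ⟨h₁, h₀⟩
  | succ j ih =>
    obtain ⟨i1, i0⟩ := ih
    constructor
    · rw [Finset.prod_range_succ, ← div_div]
      refine tendsto_div_pow_step (ha (n - 1 - j)) i1 i0
        (β := b (n - j)) (γ := a (n - j)) fun l => ?_
      have := hy l (n - j)
      simp only [smul_eq_mul] at this
      push_cast
      rw [show n - ((j : ℤ) + 1) = n - j - 1 by ring, show n - 1 - (j : ℤ) = n - j - 1 by ring]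
      linear_combination this
    · rw [show n - ((j + 1 : ℕ) : ℤ) + 1 = n - j by push_cast; ring]
      exact tendsto_div_pow_of_lt i1 (by omega)

theorem tendsto_sol_backward_zero (ha : ∀ n, a n ≠ 0) (hy : ∀ l, IsSol a b l (fun n => y n l))
    {N k : ℕ} {A : ℝ} (h₁ : Tendsto (fun l => y N l / l ^ k) atTop (𝓝 A))
    (h₀ : Tendsto (fun l => y (N + 1) l / l ^ (k + 1)) atTop (𝓝 0)) :
    Tendsto (fun l => y 0 l / l ^ (k + N)) atTop (𝓝 (A / ∏ i ∈ Finset.range N, a i)) := by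
  have h := (tendsto_sol_backward ha hy h₁ h₀ N).1
  rw [sub_self] at h
  -- The backward recursion meets the coefficients in decreasing order of the index.
  rw [← Finset.prod_range_reflect]
  convert h using 5 with i hi
  have := Finset.mem_range.1 hi
  omega

namespace PeriodicJacobi

variable {q : ℕ} (H₀ : PeriodicJacobi q)

theorem tendsto_phi (k : ℕ) :
    Tendsto (fun l : ℝ => aeval l (H₀.phi (1 + k)) / l ^ k) atTop
      (𝓝 (1 / ∏ i ∈ Finset.range k, H₀.a (1 + i))) := by
  have := (tendsto_sol_forward (y := fun n l => aeval l (H₀.phi n)) (n := 1) (k := 0) (A := 1)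
    H₀.a_ne (fun l => by simpa using H₀.isSol_phi.map (aeval l)) (by simp) (by simp) k).1
  simpa using this

theorem tendsto_phi_div_pow (k : ℕ) :
    Tendsto (fun l : ℝ => aeval l (H₀.phi k) / l ^ k) atTop (𝓝 0) := by
  cases k with
  | zero => simp
  | succ k =>
    have := tendsto_div_pow_succ (H₀.tendsto_phi k)
    rwa [show (1 : ℤ) + k = ((k + 1 : ℕ) : ℤ) by push_cast; ring] at this

/-- As ϑ₂ is constant, ϑ_{2+k} grows at most like λ^k. This bound with a spare power already makes
ϑ_q and ϑ_{q+1} negligible against λ^q. -/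
theorem tendsto_theta (k : ℕ) :
    Tendsto (fun l : ℝ => aeval l (H₀.theta (2 + k)) / l ^ (1 + k)) atTop (𝓝 0) := by
  have h2 : ∀ l : ℝ, aeval l (H₀.theta 2) = -(H₀.a 0 / H₀.a 1) := fun l => by
    have h := H₀.isSol_theta.map (aeval l) 1
    norm_num at h
    have := H₀.a_ne 1
    field_simp
    simp only [coe_aeval_eq_eval]
    linear_combination h
  have := (tendsto_sol_forward (y := fun n l => aeval l (H₀.theta n)) (n := 2) (k := 1) (A := 0)
    H₀.a_ne (fun l => by simpa using H₀.isSol_theta.map (aeval l)) (by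
      simp only [h2, pow_one]
      exact tendsto_const_nhds.div_atTop tendsto_id) (by norm_num) k).1
  simpa using this

/-- The leading coefficient of `Δ`. -/
def lead : ℝ := 1 / (∏ i ∈ Finset.range q, H₀.a (1 + i)) / 2

theorem lead_pos : 0 < H₀.lead :=
  div_pos (one_div_pos.2 (Finset.prod_pos fun _ _ => H₀.a_pos _)) two_pos

variable {H₀}

theorem tendsto_phi_next :
    Tendsto (fun l : ℝ => aeval l (H₀.phi (q + 1)) / l ^ q) atTop (𝓝 (2 * H₀.lead)) := by
  have := H₀.tendsto_phi q
  rw [add_comm (1 : ℤ)] at this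
  convert this using 2
  rw [lead]
  ring

theorem tendsto_theta_self (hq : 2 ≤ q) :
    Tendsto (fun l : ℝ => aeval l (H₀.theta q) / l ^ q) atTop (𝓝 0) := by
  obtain ⟨k, rfl⟩ := Nat.exists_eq_add_of_le hq
  have := tendsto_div_pow_succ (H₀.tendsto_theta k)
  rw [show 1 + k + 1 = 2 + k by ring] at this
  exact_mod_cast this

theorem tendsto_theta_next (hq : 2 ≤ q) :
    Tendsto (fun l : ℝ => aeval l (H₀.theta (q + 1)) / l ^ q) atTop (𝓝 0) := by
  obtain ⟨k, rfl⟩ := Nat.exists_eq_add_of_le hq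
  have := H₀.tendsto_theta (k + 1)
  rw [show 1 + (k + 1) = 2 + k by ring] at this
  rw [show ((2 + k : ℕ) : ℤ) + 1 = 2 + ((k + 1 : ℕ) : ℤ) by push_cast; ring]
  exact this

theorem tendsto_lyapunov (hq : 2 ≤ q) :
    Tendsto (fun l : ℝ => aeval l H₀.lyapunov / l ^ q) atTop (𝓝 H₀.lead) := by
  have := ((tendsto_phi_next (H₀ := H₀)).add (tendsto_theta_self (H₀ := H₀) hq)).div_const 2
  simp only [add_zero, mul_div_cancel_left₀ H₀.lead (two_ne_zero (α := ℝ))] at this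
  refine this.congr fun l => ?_
  simp only [lyapunov, map_mul, map_add, aeval_C, Algebra.algebraMap_self, RingHom.id_apply]
  ring

theorem tendsto_phiHalf (hq : 2 ≤ q) :
    Tendsto (fun l : ℝ => aeval l H₀.phiHalf / l ^ q) atTop (𝓝 H₀.lead) := by
  have := ((tendsto_phi_next (H₀ := H₀)).sub (tendsto_theta_self (H₀ := H₀) hq)).div_const 2
  simp only [sub_zero, mul_div_cancel_left₀ H₀.lead (two_ne_zero (α := ℝ))] at this
  refine this.congr fun l => ?_
  simp only [phiHalf, map_mul, map_sub, aeval_C, Algebra.algebraMap_self, RingHom.id_apply]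
  ring

variable (H₀) in
/-- The square root `√(Δ² - 1)` for large real spectral parameter. -/
def root (l : ℝ) : ℝ := √(aeval l H₀.lyapunov ^ 2 - 1)

variable (H₀) in
/-- The Weyl function `m₊` on the physical sheet, for large real spectral parameter. -/
def weyl (l : ℝ) : ℝ := (aeval l H₀.phiHalf - H₀.root l) / aeval l (H₀.phi q)

theorem tendsto_root (hq : 2 ≤ q) :
    Tendsto (fun l : ℝ => H₀.root l / l ^ q) atTop (𝓝 H₀.lead) := by
  have h1 : Tendsto (fun l : ℝ => ((l ^ q)⁻¹) ^ 2) atTop (𝓝 0) := by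
    have := ((tendsto_pow_atTop (α := ℝ) (n := q) (by omega)).inv_tendsto_atTop).pow 2
    simpa using this
  have h := (((tendsto_lyapunov (H₀ := H₀) hq).pow 2).sub h1).sqrt
  rw [sub_zero, Real.sqrt_sq H₀.lead_pos.le] at h
  refine h.congr' ?_
  filter_upwards [eventually_gt_atTop 0] with l hl
  have : (aeval l H₀.lyapunov / l ^ q) ^ 2 - ((l ^ q)⁻¹) ^ 2 =
      (aeval l H₀.lyapunov ^ 2 - 1) / (l ^ q) ^ 2 := by
    field_simp
  rw [this, Real.sqrt_div' _ (by positivity), Real.sqrt_sq (by positivity), root]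

theorem eventually_root_pos (hq : 2 ≤ q) : ∀ᶠ l in atTop, 0 < H₀.root l := by
  filter_upwards [(tendsto_root hq).eventually_const_lt H₀.lead_pos, eventually_gt_atTop 0]
    with l h hl
  exact (div_pos_iff_of_pos_right (by positivity)).1 h

theorem root_sq {l : ℝ} (h : 0 < H₀.root l) : H₀.root l ^ 2 = aeval l H₀.lyapunov ^ 2 - 1 :=
  Real.sq_sqrt (Real.sqrt_pos.1 h).le

theorem eventually_phi_ne (hq : 2 ≤ q) : ∀ᶠ l : ℝ in atTop, aeval l (H₀.phi q) ≠ 0 := by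
  obtain ⟨k, rfl⟩ := Nat.exists_eq_add_of_le (show 1 ≤ q by omega)
  have h := H₀.tendsto_phi k
  have hpos : (0 : ℝ) < 1 / ∏ i ∈ Finset.range k, H₀.a (1 + i) :=
    one_div_pos.2 (Finset.prod_pos fun _ _ => H₀.a_pos _)
  filter_upwards [h.eventually_const_lt hpos] with l hl h0
  push_cast at h0
  rw [h0] at hl
  simp at hl

/-- Rationalising the numerator, m₊ = -ϑ_{q+1} / (φ + √(Δ² - 1)). The denominator grows like λ^q and
the numerator is o(λ^q). -/
theorem tendsto_weyl (hq : 2 ≤ q) : Tendsto H₀.weyl atTop (𝓝 0) := by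
  have h := (tendsto_theta_next (H₀ := H₀) hq).neg.div ((tendsto_phiHalf hq).add (tendsto_root hq))
    (add_pos H₀.lead_pos H₀.lead_pos).ne'
  simp only [neg_zero, zero_div] at h
  refine h.congr' ?_
  filter_upwards [eventually_root_pos hq, eventually_phi_ne hq, eventually_gt_atTop 0,
    (tendsto_phiHalf hq).eventually_const_lt H₀.lead_pos] with l hR hφ hl hp
  have hp' : 0 < aeval l H₀.phiHalf := (div_pos_iff_of_pos_right (by positivity)).1 hp
  have hs : aeval l H₀.phiHalf + H₀.root l ≠ 0 := (add_pos hp' hR).ne'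
  have hd := H₀.aeval_phiHalf_sq_add l
  have hr := root_sq hR
  simp only [Pi.div_apply]
  rw [← add_div, ← neg_div, div_div_div_cancel_right₀ (by positivity), weyl,
    div_eq_div_iff hs hφ]
  linear_combination -hd + hr

variable (H₀) in
-- With m = (φ - r) / φ_q, the vector (1, m) is an eigenvector of the monodromy matrix for Δ - r. By
-- periodicity the shifted Bloch function solves the same equation, so comparison at 0 and 1
-- suffices.
theorem floquet {K : Type*} [Field K] [Algebra ℝ K] {x r : K}
    (hr : r ^ 2 = aeval x H₀.lyapunov ^ 2 - 1) (hφ : aeval x (H₀.phi q) ≠ 0) (n : ℤ) :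
    aeval x (H₀.theta (n + q)) +
        (aeval x H₀.phiHalf - r) / aeval x (H₀.phi q) * aeval x (H₀.phi (n + q)) =
      (aeval x H₀.lyapunov - r) * (aeval x (H₀.theta n) +
        (aeval x H₀.phiHalf - r) / aeval x (H₀.phi q) * aeval x (H₀.phi n)) := by
  set m := (aeval x H₀.phiHalf - r) / aeval x (H₀.phi q) with hm
  have hs : IsSol H₀.a H₀.b x (fun n => aeval x (H₀.theta n) + m * aeval x (H₀.phi n)) := by
    simpa using (H₀.isSol_theta.map (aeval x)).add_mul (H₀.isSol_phi.map (aeval x)) m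
  have hs' : IsSol H₀.a H₀.b x
      (fun n => aeval x (H₀.theta (n + q)) + m * aeval x (H₀.phi (n + q))) := fun n => by
    have := hs (n + q)
    rw [show n + (q : ℤ) - 1 = n - 1 + q by ring, show n + (q : ℤ) + 1 = n + 1 + q by ring,
      H₀.a_periodic, H₀.a_periodic, H₀.b_periodic] at this
    exact this
  have hmφ : m * aeval x (H₀.phi q) = aeval x H₀.phiHalf - r := div_mul_cancel₀ _ hφ
  refine hs'.unique 0 H₀.a_ne (hs.const_mul _) ?_ ?_ n
  · simp only [zero_add, hmφ, theta_zero, phi_zero, map_one, map_zero]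
    rw [← H₀.lyapunov_sub_phiHalf, map_sub]
    ring
  · simp only [zero_add, theta_one, phi_one, map_one, map_zero]
    rw [add_comm (1 : ℤ), ← H₀.lyapunov_add_phiHalf, map_add]
    refine mul_left_cancel₀ hφ ?_
    have hd := H₀.aeval_phiHalf_sq_add x
    linear_combination hd - hr + (aeval x H₀.phiHalf + r) * hmφ

theorem floquet_mul {K : Type*} [Field K] [Algebra ℝ K] {x r : K}
    (hr : r ^ 2 = aeval x H₀.lyapunov ^ 2 - 1) (hφ : aeval x (H₀.phi q) ≠ 0) (k : ℕ) (n : ℤ) :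
    aeval x (H₀.theta (n + (k * q : ℕ))) +
        (aeval x H₀.phiHalf - r) / aeval x (H₀.phi q) * aeval x (H₀.phi (n + (k * q : ℕ))) =
      (aeval x H₀.lyapunov - r) ^ k * (aeval x (H₀.theta n) +
        (aeval x H₀.phiHalf - r) / aeval x (H₀.phi q) * aeval x (H₀.phi n)) := by
  induction k with
  | zero => simp
  | succ k ih =>
    rw [show n + (((k + 1) * q : ℕ) : ℤ) = n + (k * q : ℕ) + q by push_cast; ring,
      H₀.floquet hr hφ, ih]
    ring

/-- The Jost solution `ψ⁺`, divided by the `k`-th power of the multiplier, equals one at `kq`. -/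
theorem tendsto_jost_aux (hq : 2 ≤ q) {a b : ℤ → ℝ} (ha : ∀ n, a n ≠ 0) {ϑ φ : ℤ → ℝ[X]}
    (hϑ : IsSol a b X ϑ) (hφ : IsSol a b X φ) (k : ℕ)
    (hϑ0 : ∀ n : ℤ, ((k * q : ℕ) : ℤ) ≤ n → ϑ n = H₀.theta n)
    (hφ0 : ∀ n : ℤ, ((k * q : ℕ) : ℤ) ≤ n → φ n = H₀.phi n) :
    Tendsto (fun l : ℝ => ((aeval l H₀.lyapunov - H₀.root l) ^ k)⁻¹ *
        (aeval l (ϑ 0) + H₀.weyl l * aeval l (φ 0)) / l ^ (k * q)) atTop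
      (𝓝 (1 / ∏ i ∈ Finset.range (k * q), a i)) := by
  have hs : ∀ l : ℝ, IsSol a b l (fun n => ((aeval l H₀.lyapunov - H₀.root l) ^ k)⁻¹ *
      (aeval l (ϑ n) + H₀.weyl l * aeval l (φ n))) := fun l => by
    simpa using ((hϑ.map (aeval l)).add_mul (hφ.map (aeval l)) _).const_mul _
  have hval : ∀ᶠ l : ℝ in atTop, ∀ n : ℤ, 0 ≤ n →
      ((aeval l H₀.lyapunov - H₀.root l) ^ k)⁻¹ * (aeval l (ϑ (n + (k * q : ℕ))) +
        H₀.weyl l * aeval l (φ (n + (k * q : ℕ)))) =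
      aeval l (H₀.theta n) + H₀.weyl l * aeval l (H₀.phi n) := by
    filter_upwards [eventually_root_pos hq, eventually_phi_ne hq] with l hR hne n hn
    have hr := root_sq hR
    -- The multipliers satisfy (Δ - r)(Δ + r) = 1, so neither vanishes.
    have hξ : aeval l H₀.lyapunov - H₀.root l ≠ 0 := fun h0 => by
      rw [sub_eq_zero] at h0
      rw [h0] at hr
      linarith
    rw [hϑ0 _ (by omega), hφ0 _ (by omega), weyl, floquet_mul hr hne,
      inv_mul_cancel_left₀ (pow_ne_zero _ hξ)]
  -- At kq and kq + 1 the normalised solution takes the values 1 and m₊ → 0, so it can be propagated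
  -- back from degree 0 with leading coefficient 1.
  have h := tendsto_sol_backward_zero ha hs (N := k * q) (k := 0) (A := 1) ?_ ?_
  · simpa using h
  · refine (tendsto_const_nhds (x := (1 : ℝ))).congr' ?_
    filter_upwards [hval] with l hl
    have := hl 0 le_rfl
    simp only [zero_add] at this
    rw [this]
    simp
  · refine Tendsto.congr' ?_ ((tendsto_weyl hq (H₀ := H₀)).div_atTop tendsto_id)
    filter_upwards [hval] with l hl
    have := hl 1 zero_le_one
    rw [add_comm (1 : ℤ)] at this
    rw [this]
    simp

end PeriodicJacobi

/-! ### Asymptotics of f₀⁺ and φ₀⁺. -/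

namespace Perturbation

variable {q : ℕ} {H₀ : PeriodicJacobi q} {p : ℕ} {V : Perturbation} {ν : ℕ}

variable (H₀ p V) in
/-- The Jost function `f₀⁺` on the physical sheet, for large real spectral parameter. -/
def jostReal (l : ℝ) : ℝ :=
  aeval l (V.thetaPlus H₀ p 0) + H₀.weyl l * aeval l (V.phiPlus H₀ p 0)

/-- The limit of `f₀⁺` at infinity on the physical sheet. -/
theorem InClass.tendsto_jostReal (hV : V.InClass H₀ p ν) (hq : 2 ≤ q) :
    Tendsto (V.jostReal H₀ p) atTop (𝓝 (V.c₁ H₀ p * ∏ i ∈ Finset.range (p + 1), H₀.a i)) := by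
  have hN : p + 1 ≤ (p + 1) * q := Nat.le_mul_of_pos_right _ (by omega)
  -- After p + 1 periods one is past the perturbation.
  have h1 := PeriodicJacobi.tendsto_jost_aux (H₀ := H₀) hq hV.a_ne hV.isSol_thetaPlus
    hV.isSol_phiPlus (p + 1) (fun n hn => hV.thetaPlus_eq (by omega))
    (fun n hn => hV.phiPlus_eq (by omega))
  have h2 := PeriodicJacobi.tendsto_jost_aux (H₀ := H₀) hq H₀.a_ne H₀.isSol_theta
    H₀.isSol_phi (p + 1) (fun n hn => rfl) (fun n hn => rfl)
  have hprod : ∀ a : ℤ → ℝ, ∏ i ∈ Finset.range ((p + 1) * q), a i =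
      (∏ i ∈ Finset.range (p + 1), a i) * ∏ i ∈ Finset.Ico (p + 1) ((p + 1) * q), a i :=
    fun a => (Finset.prod_range_mul_prod_Ico (fun i : ℕ => a i) hN).symm
  have htail : ∏ i ∈ Finset.Ico (p + 1) ((p + 1) * q), V.a H₀ (i : ℤ) =
      ∏ i ∈ Finset.Ico (p + 1) ((p + 1) * q), H₀.a (i : ℤ) :=
    Finset.prod_congr rfl fun i hi => hV.a_eq (by have := (Finset.mem_Ico.1 hi).1; omega)
  have t0 : ∏ i ∈ Finset.Ico (p + 1) ((p + 1) * q), H₀.a (i : ℤ) ≠ 0 :=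
    Finset.prod_ne_zero_iff.2 fun i _ => H₀.a_ne i
  have p0 : ∏ i ∈ Finset.range (p + 1), H₀.a (i : ℤ) ≠ 0 :=
    Finset.prod_ne_zero_iff.2 fun i _ => H₀.a_ne i
  -- For H⁰ the same quantity has ψ₀⁺ = 1, so in the quotient the multipliers, the powers of λ and
  -- the coefficients beyond p all cancel, leaving f₀⁺.
  have h := h1.div h2 (by rw [hprod]; exact one_div_ne_zero (mul_ne_zero p0 t0))
  rw [hprod, hprod, htail] at h
  have hlim : 1 / ((∏ i ∈ Finset.range (p + 1), V.a H₀ (i : ℤ)) *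
      ∏ i ∈ Finset.Ico (p + 1) ((p + 1) * q), H₀.a (i : ℤ)) /
      (1 / ((∏ i ∈ Finset.range (p + 1), H₀.a (i : ℤ)) *
      ∏ i ∈ Finset.Ico (p + 1) ((p + 1) * q), H₀.a (i : ℤ))) =
      V.c₁ H₀ p * ∏ i ∈ Finset.range (p + 1), H₀.a i := by
    rw [c₁]
    have : ∏ i ∈ Finset.range (p + 1), V.a H₀ (i : ℤ) ≠ 0 :=
      Finset.prod_ne_zero_iff.2 fun i _ => hV.a_ne i
    field_simp
  rw [hlim] at h
  refine h.congr' ?_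
  filter_upwards [PeriodicJacobi.eventually_root_pos hq, eventually_gt_atTop 0] with l hR hl
  have hξ : aeval l H₀.lyapunov - H₀.root l ≠ 0 := fun h0 => by
    have hr := PeriodicJacobi.root_sq hR
    rw [sub_eq_zero] at h0
    rw [h0] at hr
    linarith
  simp only [Pi.div_apply, jostReal, PeriodicJacobi.theta_zero, PeriodicJacobi.phi_zero, map_one,
    map_zero, mul_zero, add_zero, mul_one]
  field_simp

/-- Compare the equations of H and H⁰ at p + 1, then at p. The factor u_p (a⁰_p + a_p) is a_p² -
(a⁰_p)². -/
theorem InClass.mul_phiPlus (hV : V.InClass H₀ p ν) (x : ℝ) :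
    V.a H₀ p * V.a H₀ (p - 1) * aeval x (V.phiPlus H₀ p (p - 1)) =
      -(V.u p * (H₀.a p + V.a H₀ p)) * aeval x (H₀.phi (p + 1)) -
        H₀.a p * V.v p * aeval x (H₀.phi p) + H₀.a p * H₀.a (p - 1) * aeval x (H₀.phi (p - 1)) ∧
    V.a H₀ p * aeval x (V.phiPlus H₀ p p) = H₀.a p * aeval x (H₀.phi p) := by
  have e1 := hV.isSol_phiPlus.map (aeval x) (p + 1)
  have e2 := hV.isSol_phiPlus.map (aeval x) p
  have e3 := H₀.isSol_phi.map (aeval x) (p + 1)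
  have e4 := H₀.isSol_phi.map (aeval x) p
  simp only [phiPlus_start, phiPlus_next] at e1
  rw [hV.a_eq (n := (p : ℤ) + 1) (by omega),
    hV.b_eq (n := (p : ℤ) + 1) (by omega)] at e1
  simp only [phiPlus_start] at e2
  simp only [add_sub_cancel_right, smul_eq_mul, aeval_X] at e1 e2 e3 e4
  have h : V.a H₀ p * aeval x (V.phiPlus H₀ p p) = H₀.a p * aeval x (H₀.phi p) := by
    linear_combination e1 - e3
  refine ⟨?_, h⟩
  have hb : V.b H₀ p = H₀.b p + V.v p := rfl
  have ha : V.a H₀ p = H₀.a p + V.u p := rfl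
  rw [hb] at e2
  linear_combination V.a H₀ p * e2 - H₀.a p * e4 + (x - H₀.b p - V.v p) * h +
    (-V.a H₀ p - H₀.a p) * aeval x (H₀.phi (p + 1)) * ha

theorem InClass.c₁_pos (hV : V.InClass H₀ p ν) : 0 < V.c₁ H₀ p :=
  one_div_pos.2 (Finset.prod_pos fun _ _ => hV.a_pos _)

theorem InClass.c₂_ne (hV : V.InClass H₀ p ν) : V.c₂ H₀ p ν ≠ 0 := by
  have h1 := hV.c₁_pos.ne'
  have h2 := H₀.a_ne p
  have h3 := (add_pos (H₀.a_pos p) (hV.a_pos p)).ne'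
  rw [c₂]
  rcases hV.last with ⟨h, hu⟩ | ⟨h, hu, hv⟩
  · rw [if_pos h]
    positivity
  · rw [if_neg (by omega)]
    positivity

/-- The leading term of `φ⁺₀`. -/
theorem InClass.tendsto_phiPlus (hV : V.InClass H₀ p ν) (hp : 1 ≤ p) :
    Tendsto (fun l : ℝ => aeval l (V.phiPlus H₀ p 0) / l ^ (ν - 1)) atTop
      (𝓝 (-V.c₂ H₀ p ν / ∏ i ∈ Finset.range p, H₀.a (1 + i))) := by
  obtain ⟨r, rfl⟩ : ∃ r, p = r + 1 := ⟨p - 1, by omega⟩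
  have hsol : ∀ l : ℝ, IsSol (V.a H₀) (V.b H₀) l (fun n => aeval l (V.phiPlus H₀ (r + 1) n)) :=
    fun l => by simpa using hV.isSol_phiPlus.map (aeval l)
  have a1 := hV.a_ne ((r + 1 : ℕ) : ℤ)
  have a2 := hV.a_ne (r : ℤ)
  have er : ((r + 1 : ℕ) : ℤ) - 1 = r := by push_cast; ring
  have e1 : ∀ l : ℝ, aeval l (V.phiPlus H₀ (r + 1) r) =
      (-(V.u (r + 1 : ℕ) * (H₀.a (r + 1 : ℕ) + V.a H₀ (r + 1 : ℕ))) *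
        aeval l (H₀.phi (1 + (r + 1 : ℕ))) -
        H₀.a (r + 1 : ℕ) * V.v (r + 1 : ℕ) * aeval l (H₀.phi (1 + r)) +
        H₀.a (r + 1 : ℕ) * H₀.a r * aeval l (H₀.phi r)) /
        (V.a H₀ (r + 1 : ℕ) * V.a H₀ r) := fun l => by
    rw [eq_div_iff (mul_ne_zero a1 a2)]
    have := (hV.mul_phiPlus l).1
    rw [er] at this
    rw [add_comm (1 : ℤ) (r + 1 : ℕ), show (1 : ℤ) + r = (r + 1 : ℕ) by push_cast; ring]
    linear_combination this
  have e2 : ∀ l : ℝ, aeval l (V.phiPlus H₀ (r + 1) (r + 1)) =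
      H₀.a (r + 1 : ℕ) / V.a H₀ (r + 1 : ℕ) * aeval l (H₀.phi (1 + r)) := fun l => by
    have := (hV.mul_phiPlus l).2
    rw [show (1 : ℤ) + r = (r + 1 : ℕ) by push_cast; ring]
    field_simp
    rw [← this]
    push_cast
    ring
  have hc₁ : V.c₁ H₀ (r + 1) = 1 / ((∏ i ∈ Finset.range r, V.a H₀ (i : ℤ)) * V.a H₀ r *
      V.a H₀ (r + 1 : ℕ)) := by
    rw [c₁, Finset.prod_range_succ, Finset.prod_range_succ]
  have q1 : ∏ i ∈ Finset.range r, V.a H₀ (i : ℤ) ≠ 0 :=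
    Finset.prod_ne_zero_iff.2 fun i _ => hV.a_ne i
  have q2 : ∏ i ∈ Finset.range r, H₀.a (1 + (i : ℤ)) ≠ 0 :=
    Finset.prod_ne_zero_iff.2 fun i _ => H₀.a_ne _
  have q3 := H₀.a_ne (1 + r)
  have t3 := H₀.tendsto_phi_div_pow r
  have t2 := H₀.tendsto_phi r
  have t1 := H₀.tendsto_phi (r + 1)
  rcases hV.last with ⟨h, hu⟩ | ⟨h, hu, hv⟩
  -- Case ν = 2p: the term with φ_{p+1} dominates, φ⁺_{p-1} has degree p, and p - 1 backward steps
  -- give degree ν - 1.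
  · have k1 := (((t1.const_mul (-(V.u (r + 1 : ℕ) * (H₀.a (r + 1 : ℕ) + V.a H₀ (r + 1 : ℕ))))).sub
      ((tendsto_div_pow_succ t2).const_mul (H₀.a (r + 1 : ℕ) * V.v (r + 1 : ℕ)))).add
      ((tendsto_div_pow_succ t3).const_mul (H₀.a (r + 1 : ℕ) * H₀.a r))).div_const
        (V.a H₀ (r + 1 : ℕ) * V.a H₀ r)
    have k2 := (tendsto_div_pow_of_lt t2 (show r < r + 2 by omega)).const_mul
      (H₀.a (r + 1 : ℕ) / V.a H₀ (r + 1 : ℕ))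
    have k := tendsto_sol_backward_zero hV.a_ne hsol (N := r) (k := r + 1)
      (k1.congr fun l => by rw [e1]; ring)
      (by rw [mul_zero] at k2; exact k2.congr fun l => by rw [e2]; ring)
    rw [show ν - 1 = r + 1 + r by omega]
    convert k using 2
    rw [c₂, if_pos h, hc₁, Finset.prod_range_succ]
    field_simp
    ring
  -- Case ν = 2p - 1: as u_p = 0, the term with φ_p dominates and φ⁺_{p-1} has degree p - 1. The
  -- total is again ν - 1.
  · have k1 := ((t2.const_mul (-(H₀.a (r + 1 : ℕ) * V.v (r + 1 : ℕ)))).add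
      (t3.const_mul (H₀.a (r + 1 : ℕ) * H₀.a r))).div_const
        (V.a H₀ (r + 1 : ℕ) * V.a H₀ r)
    have k2 := (tendsto_div_pow_succ t2).const_mul
      (H₀.a (r + 1 : ℕ) / V.a H₀ (r + 1 : ℕ))
    have k := tendsto_sol_backward_zero hV.a_ne hsol (N := r) (k := r)
      (k1.congr fun l => by rw [e1, hu]; ring)
      (by rw [mul_zero] at k2; exact k2.congr fun l => by rw [e2]; ring)
    rw [show ν - 1 = r + r by omega]
    convert k using 2
    have ha : V.a H₀ (r + 1 : ℕ) = H₀.a (r + 1 : ℕ) := by rw [Perturbation.a, hu, add_zero]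
    rw [c₂, if_neg (by omega), hc₁, Finset.prod_range_succ, ha]
    rw [show (1 : ℤ) + r = (r + 1 : ℕ) by push_cast; ring] at *
    field_simp
    ring

end Perturbation

/-! ### Orders of zeros and poles -/

theorem meromorphicOrderAt_pos_iff_of_analyticAt {g : ℂ → ℂ} {x : ℂ} (hg : AnalyticAt ℂ g x) :
    0 < meromorphicOrderAt g x ↔ g x = 0 := by
  have hc : Tendsto g (𝓝[≠] x) (𝓝 (g x)) := hg.continuousAt.tendsto.mono_left nhdsWithin_le_nhds
  rw [← tendsto_zero_iff_meromorphicOrderAt_pos hg.meromorphicAt]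
  exact ⟨fun h => tendsto_nhds_unique hc h, fun h => h ▸ hc⟩

theorem meromorphicOrderAt_eq_zero_of_analyticAt {g : ℂ → ℂ} {x : ℂ} (hg : AnalyticAt ℂ g x)
    (h : g x ≠ 0) : meromorphicOrderAt g x = 0 :=
  (tendsto_ne_zero_iff_meromorphicOrderAt_eq_zero hg.meromorphicAt).1
    ⟨g x, h, hg.continuousAt.tendsto.mono_left nhdsWithin_le_nhds⟩

theorem meromorphicOrderAt_aeval {p : ℝ[X]} (hp : p ≠ 0) (z : ℂ) :
    meromorphicOrderAt (fun t => aeval (z + t) p) 0 =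
      ((p.map (algebraMap ℝ ℂ)).rootMultiplicity z : ℤ) := by
  have hp' : p.map (algebraMap ℝ ℂ) ≠ 0 := by simpa using hp
  obtain ⟨r, hr, hd⟩ := exists_eq_pow_rootMultiplicity_mul_and_not_dvd _ hp' z
  have han : ∀ s : ℂ[X], AnalyticAt ℂ (fun t : ℂ => aeval (z + t) s) 0 := fun s =>
    (analyticAt_const.add analyticAt_id).aeval_polynomial s
  have han' : AnalyticAt ℂ (fun t : ℂ => aeval (z + t) p) 0 := by
    simpa using han (p.map (algebraMap ℝ ℂ))
  rw [meromorphicOrderAt_eq_int_iff han'.meromorphicAt]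
  refine ⟨fun t => aeval (z + t) r, han r, ?_, Eventually.of_forall fun t => ?_⟩
  · rw [dvd_iff_isRoot, IsRoot.def] at hd
    simpa using hd
  · have := congrArg (eval (z + t)) hr
    simpa [eval_map_algebraMap] using this

theorem exists_aeval_eq_sub_mul {p : ℝ[X]} {z : ℂ} (h : aeval z p = 0) :
    ∃ r : ℂ[X], (∀ x : ℂ, aeval x p = (x - z) * aeval x r) ∧
      aeval z r = aeval z (derivative p) := by
  have h' : IsRoot (p.map (algebraMap ℝ ℂ)) z := by simpa [IsRoot.def, eval_map_algebraMap] using h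
  obtain ⟨r, hr⟩ := dvd_iff_isRoot.2 h'
  refine ⟨r, fun x => ?_, ?_⟩
  · have := congrArg (eval x) hr
    simpa [eval_map_algebraMap] using this
  · have := congrArg (fun s => eval z (derivative s)) hr
    simp [derivative_map, eval_map_algebraMap] at this
    simpa using this.symm

/-! ### Local analysis on Λ. -/

namespace PeriodicJacobi

variable {q : ℕ} {H₀ : PeriodicJacobi q} {P : ℂ × ℂ}

theorem phi_q_ne_zero (hq : 2 ≤ q) : H₀.phi q ≠ 0 := by
  obtain ⟨l, hl⟩ := (eventually_phi_ne (H₀ := H₀) hq).exists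
  intro h
  simp [h] at hl

theorem chart_of_ne (h : P.2 ≠ 0) (t : ℂ) : H₀.chart P t =
    (P.1 + t, P.2 * ((1 - H₀.disc (P.1 + t) ^ 2) / P.2 ^ 2) ^ (1 / 2 : ℂ)) := by
  rw [chart, if_neg h]

theorem chart_neg (h : P.2 ≠ 0) (t : ℂ) :
    H₀.chart (P.1, -P.2) t = ((H₀.chart P t).1, -(H₀.chart P t).2) := by
  rw [chart_of_ne h, chart_of_ne (by simpa using h)]
  simp

variable (H₀ P) in
/-- The derivative of `1 - Δ²`. -/
def edgeDeriv : ℂ :=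
  -2 * H₀.disc P.1 * aeval P.1 (derivative H₀.lyapunov)

theorem edgeDeriv_ne (hgaps : H₀.AllGapsOpen) (hP : P ∈ H₀.surface) (h : P.2 = 0) :
    H₀.edgeDeriv P ≠ 0 := by
  have hP' : P.2 ^ 2 = 1 - H₀.disc P.1 ^ 2 := hP
  have h1 : H₀.disc P.1 ^ 2 = 1 := by rw [h] at hP'; linear_combination hP'
  have h2 : H₀.disc P.1 ≠ 0 := fun h0 => by simp [h0] at h1
  exact mul_ne_zero (mul_ne_zero (by norm_num) h2) (hgaps _ h1)

theorem chart_of_eq (h : P.2 = 0) (t : ℂ) : H₀.chart P t =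
    (P.1 + t ^ 2 / H₀.edgeDeriv P, t * ((1 - H₀.disc (P.1 + t ^ 2 / H₀.edgeDeriv P) ^ 2) / t ^ 2)
      ^ (1 / 2 : ℂ)) := by
  rw [chart, if_pos h]
  rfl

theorem analyticAt_chart_fst : AnalyticAt ℂ (fun t => (H₀.chart P t).1) 0 := by
  by_cases h : P.2 = 0
  · simp only [chart_of_eq h]
    exact analyticAt_const.add ((analyticAt_id.pow 2).div_const)
  · simp only [chart_of_ne h]
    exact analyticAt_const.add analyticAt_id

theorem analyticAt_aeval_chart (p : ℝ[X]) :
    AnalyticAt ℂ (fun t => aeval (H₀.chart P t).1 p) 0 := by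
  simpa using analyticAt_chart_fst.aeval_polynomial (p.map (algebraMap ℝ ℂ))

/-- At an edge 1 - Δ² = (λ - λ(P)) r(λ), and r(λ(P)) is the derivative D ≠ 0 because gaps are open.
The argument of the root is then r / D, close to 1 and away from the cut. Elsewhere that argument is
1 at t = 0. -/
theorem analyticAt_chart_snd (hgaps : H₀.AllGapsOpen) (hP : P ∈ H₀.surface) :
    AnalyticAt ℂ (fun t => (H₀.chart P t).2) 0 := by
  have hP' : P.2 ^ 2 = 1 - H₀.disc P.1 ^ 2 := hP
  by_cases h : P.2 = 0
  · have hD := edgeDeriv_ne hgaps hP h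
    have h0 : aeval P.1 (1 - H₀.lyapunov ^ 2) = 0 := by
      rw [h] at hP'
      simp only [map_sub, map_one, map_pow]
      rw [disc] at hP'
      linear_combination -hP'
    obtain ⟨r, hr, hr'⟩ := exists_aeval_eq_sub_mul h0
    have hr'' : aeval P.1 r = H₀.edgeDeriv P := by
      rw [hr', edgeDeriv, disc]
      simp [derivative_sq]
    have hg : AnalyticAt ℂ
        (fun t => aeval (P.1 + t ^ 2 / H₀.edgeDeriv P) r / H₀.edgeDeriv P) 0 :=
      (AnalyticAt.aeval_polynomial
        (analyticAt_const.add ((analyticAt_id.pow 2).div_const)) r).div_const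
    have hfun : (fun t => (H₀.chart P t).2) = fun t =>
        t * (aeval (P.1 + t ^ 2 / H₀.edgeDeriv P) r / H₀.edgeDeriv P) ^ (1 / 2 : ℂ) := by
      funext t
      rw [chart_of_eq h]
      -- At t = 0 the quotient by t² is meaningless, but the factor t makes both sides vanish.
      by_cases ht : t = 0
      · simp [ht]
      · have := hr (P.1 + t ^ 2 / H₀.edgeDeriv P)
        simp only [map_sub, map_one, map_pow, add_sub_cancel_left] at this
        simp only [disc]
        rw [this]
        congr 2
        field_simp
    rw [hfun]
    refine analyticAt_id.mul (hg.cpow analyticAt_const ?_)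
    simp [hr'', hD]
  · simp only [chart_of_ne h]
    refine analyticAt_const.mul (AnalyticAt.cpow ?_ analyticAt_const ?_)
    · refine AnalyticAt.div_const (analyticAt_const.sub (AnalyticAt.pow ?_ 2))
      simp only [disc]
      have : AnalyticAt ℂ (fun t : ℂ => P.1 + t) 0 := analyticAt_const.add analyticAt_id
      simpa using this.aeval_polynomial (H₀.lyapunov.map (algebraMap ℝ ℂ))
    · rw [add_zero, ← hP', div_self (pow_ne_zero 2 h)]
      simp

theorem tendsto_chart_fst (hgaps : H₀.AllGapsOpen) (hP : P ∈ H₀.surface) :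
    Tendsto (fun t => (H₀.chart P t).1) (𝓝[≠] 0) (𝓝[≠] P.1) := by
  refine tendsto_nhdsWithin_iff.2 ⟨?_, ?_⟩
  · have := (analyticAt_chart_fst (H₀ := H₀) (P := P)).continuousAt.tendsto
    rw [H₀.chart_zero hP] at this
    exact this.mono_left nhdsWithin_le_nhds
  · filter_upwards [self_mem_nhdsWithin] with t ht
    have ht : t ≠ 0 := ht
    by_cases h : P.2 = 0
    · simp [chart_of_eq h, ht, edgeDeriv_ne hgaps hP h]
    · simp [chart_of_ne h, ht]

/-- Applied to φ_q, this lets orders be computed from formulas valid only off the Dirichlet points.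
-/
theorem eventually_aeval_chart_ne (hgaps : H₀.AllGapsOpen) (hP : P ∈ H₀.surface) {p : ℝ[X]}
    (hp : p ≠ 0) : ∀ᶠ t in 𝓝[≠] 0, aeval (H₀.chart P t).1 p ≠ 0 := by
  have hfin : ({z : ℂ | aeval z p = 0} \ {P.1}).Finite := by
    refine (p.rootSet_finite ℂ).subset fun z hz => ?_
    rw [mem_rootSet]
    exact ⟨hp, hz.1⟩
  have : ∀ᶠ z in 𝓝[≠] P.1, aeval z p ≠ 0 := by
    filter_upwards [self_mem_nhdsWithin, nhdsWithin_le_nhds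
      (hfin.isClosed.isOpen_compl.mem_nhds (x := P.1) (by simp))] with z hz hz' h0
    exact hz' ⟨h0, hz⟩
  exact (tendsto_chart_fst hgaps hP).eventually this

theorem meromorphicAt_mPlus (hgaps : H₀.AllGapsOpen) (hP : P ∈ H₀.surface) :
    MeromorphicAt (fun t => H₀.mPlus (H₀.chart P t)) 0 :=
  ((analyticAt_aeval_chart _).add
    (analyticAt_const.mul (analyticAt_chart_snd hgaps hP))).meromorphicAt.div
      (analyticAt_aeval_chart _).meromorphicAt

theorem surface_neg (hP : P ∈ H₀.surface) : (P.1, -P.2) ∈ H₀.surface := by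
  have hP' : P.2 ^ 2 = 1 - H₀.disc P.1 ^ 2 := hP
  simpa [surface] using hP'

end PeriodicJacobi

/-! ### The divisor of f₀⁺ and the roots of N. -/

namespace Perturbation

open PeriodicJacobi

variable {q : ℕ} {H₀ : PeriodicJacobi q} {p : ℕ} {V : Perturbation} {ν : ℕ} {P : ℂ × ℂ}

theorem InClass.meromorphicAt_jostPlus (hV : V.InClass H₀ p ν) (hgaps : H₀.AllGapsOpen)
    (hP : P ∈ H₀.surface) (n : ℤ) :
    MeromorphicAt (fun t => V.jostPlus H₀ p n (H₀.chart P t)) 0 := by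
  simp only [hV.jostPlus_eq]
  exact (analyticAt_aeval_chart _).meromorphicAt.add
    ((meromorphicAt_mPlus hgaps hP).mul (analyticAt_aeval_chart _).meromorphicAt)

/-- Away from the Dirichlet points `f⁺` is analytic on `Λ`. -/
theorem InClass.analyticAt_jostPlus (hV : V.InClass H₀ p ν) (hgaps : H₀.AllGapsOpen)
    (hP : P ∈ H₀.surface) (hφ : aeval P.1 (H₀.phi q) ≠ 0) (n : ℤ) :
    AnalyticAt ℂ (fun t => V.jostPlus H₀ p n (H₀.chart P t)) 0 := by
  simp only [hV.jostPlus_eq, mPlus]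
  refine (analyticAt_aeval_chart _).add ((AnalyticAt.div ((analyticAt_aeval_chart _).add
    (analyticAt_const.mul (analyticAt_chart_snd hgaps hP))) (analyticAt_aeval_chart _) ?_).mul
      (analyticAt_aeval_chart _))
  rwa [H₀.chart_zero hP]

theorem InClass.wHat_eventuallyEq (hV : V.InClass H₀ p ν) (hq : 2 ≤ q) (hgaps : H₀.AllGapsOpen)
    (hP : P ∈ H₀.surface) :
    (fun t => V.wHat H₀ p (H₀.chart P t)) =ᶠ[𝓝[≠] 0] fun t =>
      (aeval (H₀.chart P t).1 (V.wEven H₀ p) +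
        Complex.I * (H₀.chart P t).2 * aeval (H₀.chart P t).1 (V.wOdd H₀ p)) / H₀.a 0 := by
  filter_upwards [eventually_aeval_chart_ne hgaps hP (phi_q_ne_zero hq)] with t ht
  exact hV.wHat_eq (H₀.chart_mem hP t) ht

theorem analyticAt_wHat (hgaps : H₀.AllGapsOpen) (hP : P ∈ H₀.surface) :
    AnalyticAt ℂ (fun t => (aeval (H₀.chart P t).1 (V.wEven H₀ p) +
      Complex.I * (H₀.chart P t).2 * aeval (H₀.chart P t).1 (V.wOdd H₀ p)) / H₀.a 0) 0 :=
  ((analyticAt_aeval_chart _).add ((analyticAt_const.mul (analyticAt_chart_snd hgaps hP)).mul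
    (analyticAt_aeval_chart _))).div_const

theorem InClass.ordAt_wHat_nonneg (hV : V.InClass H₀ p ν) (hq : 2 ≤ q) (hgaps : H₀.AllGapsOpen)
    (hP : P ∈ H₀.surface) : 0 ≤ H₀.ordAt (V.wHat H₀ p) P := by
  rw [ordAt, meromorphicOrderAt_congr (hV.wHat_eventuallyEq hq hgaps hP)]
  exact (analyticAt_wHat hgaps hP).meromorphicOrderAt_nonneg

theorem InClass.wHat_eq_zero (hV : V.InClass H₀ p ν) (hq : 2 ≤ q) (hgaps : H₀.AllGapsOpen)
    (hP : P ∈ H₀.surface) (hφ : aeval P.1 (H₀.phi q) ≠ 0)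
    (h : 0 < H₀.ordAt (V.wHat H₀ p) P) : V.wHat H₀ p P = 0 := by
  rw [ordAt, meromorphicOrderAt_congr (hV.wHat_eventuallyEq hq hgaps hP),
    meromorphicOrderAt_pos_iff_of_analyticAt (analyticAt_wHat hgaps hP), H₀.chart_zero hP] at h
  rw [hV.wHat_eq hP hφ, h]

/-- Infinite order is positive, so it would count as a zero and would have to equal 1. -/
theorem ordAt_ne_top {F : ℂ × ℂ → ℂ} (hF : H₀.OnlySimpleZeros F) (hP : P ∈ H₀.surface) :
    H₀.ordAt F P ≠ ⊤ := fun h => by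
  have h1 : P ∈ H₀.zeroSet F := ⟨hP, by rw [h]; exact WithTop.coe_lt_top 0⟩
  have := hF P h1
  rw [h] at this
  exact absurd this (by decide)

theorem ordAt_le_one {F : ℂ × ℂ → ℂ} (hF : H₀.OnlySimpleZeros F) (hP : P ∈ H₀.surface) :
    H₀.ordAt F P ≤ 1 := by
  by_cases h : 0 < H₀.ordAt F P
  · exact (hF P ⟨hP, h⟩).le
  · exact (not_lt.1 h).trans zero_le_one

/-- Orders add in (R₋ + 1) ŵ = 2iΩ f₀⁺, an identity valid near P because ŵ has finite order there.
-/
theorem InClass.ordAt_refl_add (hV : V.InClass H₀ p ν) (hq : 2 ≤ q) (hgaps : H₀.AllGapsOpen)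
    (hgen : V.Generic H₀ p) (hP : P ∈ H₀.surface) :
    H₀.ordAt (V.reflMinusAddOne H₀ p) P + H₀.ordAt (V.wHat H₀ p) P =
      H₀.ordAt (fun Q => 2 * Complex.I * Q.2) P + H₀.ordAt (V.jostPlus H₀ p 0) P := by
  have hw : MeromorphicAt (fun t => V.wHat H₀ p (H₀.chart P t)) 0 :=
    (analyticAt_wHat hgaps hP).meromorphicAt.congr (hV.wHat_eventuallyEq hq hgaps hP).symm
  have hΩ : MeromorphicAt (fun t => 2 * Complex.I * (H₀.chart P t).2) 0 :=
    (analyticAt_const.mul (analyticAt_chart_snd hgaps hP)).meromorphicAt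
  have hf := hV.meromorphicAt_jostPlus hgaps hP 0
  have hne : ∀ᶠ t in 𝓝[≠] 0, V.wHat H₀ p (H₀.chart P t) ≠ 0 :=
    (meromorphicOrderAt_ne_top_iff_eventually_ne_zero hw).1 (ordAt_ne_top hgen.simple_wHat hP)
  have hmul : ∀ᶠ t in 𝓝[≠] 0,
      V.reflMinusAddOne H₀ p (H₀.chart P t) * V.wHat H₀ p (H₀.chart P t) =
        2 * Complex.I * (H₀.chart P t).2 * V.jostPlus H₀ p 0 (H₀.chart P t) := by
    filter_upwards [hne] with t ht using hV.reflMinusAddOne_mul ht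
  have hR : MeromorphicAt (fun t => V.reflMinusAddOne H₀ p (H₀.chart P t)) 0 := by
    refine ((hΩ.mul hf).div hw).congr ?_
    filter_upwards [hne, hmul] with t ht ht'
    simp only [Pi.div_apply, Pi.mul_apply]
    rw [← ht', mul_div_cancel_right₀ _ ht]
  unfold ordAt
  rw [← fun_meromorphicOrderAt_mul hR hw, ← fun_meromorphicOrderAt_mul hΩ hf]
  exact meromorphicOrderAt_congr hmul

theorem InClass.ordAt_jostPlus_ne_top (hV : V.InClass H₀ p ν) (hq : 2 ≤ q)
    (hgaps : H₀.AllGapsOpen) (hgen : V.Generic H₀ p) (hP : P ∈ H₀.surface) :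
    H₀.ordAt (V.jostPlus H₀ p 0) P ≠ ⊤ := by
  intro h
  have e := hV.ordAt_refl_add hq hgaps hgen hP
  rw [h, add_top, WithTop.add_eq_top] at e
  exact e.elim (ordAt_ne_top hgen.simple_refl hP) (ordAt_ne_top hgen.simple_wHat hP)

theorem ordAt_snd_eq_zero (hgaps : H₀.AllGapsOpen) (hP : P ∈ H₀.surface) (h : P.2 ≠ 0) :
    H₀.ordAt (fun Q => 2 * Complex.I * Q.2) P = 0 := by
  refine meromorphicOrderAt_eq_zero_of_analyticAt
    (analyticAt_const.mul (analyticAt_chart_snd hgaps hP)) ?_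
  simpa [H₀.chart_zero hP] using h

theorem ordAt_snd_pos (hgaps : H₀.AllGapsOpen) (hP : P ∈ H₀.surface) (h : P.2 = 0) :
    0 < H₀.ordAt (fun Q => 2 * Complex.I * Q.2) P := by
  refine (meromorphicOrderAt_pos_iff_of_analyticAt
    (analyticAt_const.mul (analyticAt_chart_snd hgaps hP))).2 ?_
  simpa [H₀.chart_zero hP] using h

/-- Away from edges and Dirichlet points the zeros of `f₀⁺` are those of `R₋ + 1`, and simple. -/
theorem InClass.ordAt_jostPlus_of_phi_ne (hV : V.InClass H₀ p ν) (hq : 2 ≤ q)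
    (hgaps : H₀.AllGapsOpen) (hgen : V.Generic H₀ p) (hP : P ∈ H₀.surface) (hΩ : P.2 ≠ 0)
    (hφ : aeval P.1 (H₀.phi q) ≠ 0) [Decidable (P ∈ H₀.zeroSet (V.reflMinusAddOne H₀ p))] :
    H₀.ordAt (V.jostPlus H₀ p 0) P =
      if P ∈ H₀.zeroSet (V.reflMinusAddOne H₀ p) then 1 else 0 := by
  have e := hV.ordAt_refl_add hq hgaps hgen hP
  rw [ordAt_snd_eq_zero hgaps hP hΩ, zero_add] at e
  have hf := hV.analyticAt_jostPlus hgaps hP hφ 0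
  have hf0 : 0 ≤ H₀.ordAt (V.jostPlus H₀ p 0) P := hf.meromorphicOrderAt_nonneg
  have hw0 := hV.ordAt_wHat_nonneg hq hgaps hP
  -- In ord(R₋ + 1) + ord ŵ = ord f₀⁺ the last two are non-negative and not both positive. Hence f₀⁺
  -- vanishes exactly where R₋ + 1 does, to the same order.
  have hnc : ¬ (0 < H₀.ordAt (V.jostPlus H₀ p 0) P ∧ 0 < H₀.ordAt (V.wHat H₀ p) P) := by
    rintro ⟨h1, h2⟩
    have h1 := (meromorphicOrderAt_pos_iff_of_analyticAt hf).1 h1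
    rw [H₀.chart_zero hP] at h1
    have h2 := hV.wHat_eq_zero hq hgaps hP hφ h2
    have ha : (H₀.a 0 : ℂ) ≠ 0 := by exact_mod_cast H₀.a_ne 0
    rw [wHat, mul_eq_zero] at h2
    exact h2.elim (div_ne_zero hφ ha) (hV.w_ne_zero h1)
  have tR := ordAt_ne_top hgen.simple_refl hP
  have tw := ordAt_ne_top hgen.simple_wHat hP
  have tf := hV.ordAt_jostPlus_ne_top hq hgaps hgen hP
  have hR1 := hgen.simple_refl P
  have hw1 := ordAt_le_one hgen.simple_wHat hP
  have hR : P ∈ H₀.zeroSet (V.reflMinusAddOne H₀ p) ↔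
      0 < H₀.ordAt (V.reflMinusAddOne H₀ p) P := ⟨fun h => h.2, fun h => ⟨hP, h⟩⟩
  simp only [hR] at hR1 ⊢
  generalize H₀.ordAt (V.reflMinusAddOne H₀ p) P = oR at *
  generalize H₀.ordAt (V.wHat H₀ p) P = ow at *
  generalize H₀.ordAt (V.jostPlus H₀ p 0) P = of at *
  lift oR to ℤ using tR
  lift ow to ℤ using tw
  lift of to ℤ using tf
  norm_cast at *
  split_ifs with h
  · have := hR1 h
    norm_cast
    omega
  · norm_cast
    omega

theorem InClass.ordAt_jostPlus_dirichlet (hV : V.InClass H₀ p ν) (hq : 2 ≤ q)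
    (hgaps : H₀.AllGapsOpen) (hgen : V.Generic H₀ p) (hP : P ∈ H₀.surface)
    (hφ : aeval P.1 (H₀.phi q) = 0) :
    H₀.ordAt (fun Q => 2 * Complex.I * Q.2) P + H₀.ordAt (V.jostPlus H₀ p 0) P ≤ 0 := by
  have e := hV.ordAt_refl_add hq hgaps hgen hP
  have hD : P ∈ H₀.dirichletPoints := ⟨hP, hφ⟩
  have hw : ¬ 0 < H₀.ordAt (V.wHat H₀ p) P := fun h =>
    Set.disjoint_left.1 hgen.wHat_dirichlet ⟨hP, h⟩ hD
  have hR : ¬ 0 < H₀.ordAt (V.reflMinusAddOne H₀ p) P := fun h =>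
    Set.disjoint_left.1 hgen.refl_dirichlet ⟨hP, h⟩ hD
  rw [← e]
  exact add_nonpos (not_lt.1 hR) (not_lt.1 hw)

/-- At a Dirichlet point away from the edges, the order of `f₀⁺` is determined by `φ⁺₀`. -/
theorem InClass.ordAt_jostPlus_of_phi_eq (hV : V.InClass H₀ p ν) (hq : 2 ≤ q)
    (hgaps : H₀.AllGapsOpen) (hgen : V.Generic H₀ p) (hP : P ∈ H₀.surface) (hΩ : P.2 ≠ 0)
    (hφ : aeval P.1 (H₀.phi q) = 0) :
    H₀.ordAt (V.jostPlus H₀ p 0) P =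
      min 0 (H₀.ordAt (fun Q => H₀.mPlus Q * aeval Q.1 (V.phiPlus H₀ p 0)) P) := by
  have e := hV.ordAt_jostPlus_dirichlet hq hgaps hgen hP hφ
  rw [ordAt_snd_eq_zero hgaps hP hΩ, zero_add] at e
  have h1 : AnalyticAt ℂ (fun t => aeval (H₀.chart P t).1 (V.thetaPlus H₀ p 0)) 0 :=
    analyticAt_aeval_chart _
  have h2 : MeromorphicAt (fun t => H₀.mPlus (H₀.chart P t) *
      aeval (H₀.chart P t).1 (V.phiPlus H₀ p 0)) 0 :=
    (meromorphicAt_mPlus hgaps hP).mul (analyticAt_aeval_chart _).meromorphicAt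
  have hf : H₀.ordAt (V.jostPlus H₀ p 0) P = meromorphicOrderAt
      ((fun t => aeval (H₀.chart P t).1 (V.thetaPlus H₀ p 0)) + fun t => H₀.mPlus (H₀.chart P t) *
        aeval (H₀.chart P t).1 (V.phiPlus H₀ p 0)) 0 := by
    simp only [ordAt, hV.jostPlus_eq]
    rfl
  rw [hf] at e ⊢
  have h10 := h1.meromorphicOrderAt_nonneg
  unfold ordAt
  -- A pole of m₊ φ₀⁺ dominates the analytic ϑ₀⁺. Without a pole f₀⁺ is regular, and genericity
  -- forbids a zero.
  rcases lt_or_ge (meromorphicOrderAt (fun t => H₀.mPlus (H₀.chart P t) *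
      aeval (H₀.chart P t).1 (V.phiPlus H₀ p 0)) 0) 0 with h | h
  · rw [min_eq_right h.le, meromorphicOrderAt_add_eq_right_of_lt h1.meromorphicAt
      (h.trans_le h10)]
  · rw [min_eq_left h]
    exact le_antisymm e ((le_min h10 h).trans (meromorphicOrderAt_add h1.meromorphicAt h2))

/-- The polynomial `φ_q f₀⁺ (f₀⁺)*` does not vanish at the band edges. -/
theorem InClass.aeval_normPoly_ne_zero (hV : V.InClass H₀ p ν) (hq : 2 ≤ q)
    (hgaps : H₀.AllGapsOpen) (hgen : V.Generic H₀ p) (hP : P ∈ H₀.surface) (hΩ : P.2 = 0) :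
    aeval P.1 (V.normPoly H₀ p) ≠ 0 := by
  intro h0
  have hpos := ordAt_snd_pos hgaps hP hΩ
  by_cases hφ : aeval P.1 (H₀.phi q) = 0
  -- At an edge which is a Dirichlet eigenvalue, Ω has a zero, so a regular f₀⁺ contradicts `hle`.
  -- Regularity will follow from N(P) = 0.
  · have hle := hV.ordAt_jostPlus_dirichlet hq hgaps hgen hP hφ
    suffices hf0 : 0 ≤ H₀.ordAt (V.jostPlus H₀ p 0) P from
      absurd hle (not_le.2 (add_pos_of_pos_of_nonneg hpos hf0))
    have hP' : P.2 ^ 2 = 1 - (aeval P.1 H₀.lyapunov) ^ 2 := hP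
    rw [hΩ] at hP'
    have hd := H₀.aeval_phiHalf_sq_add P.1
    rw [hφ] at hd
    have hhalf : aeval P.1 H₀.phiHalf = 0 := by
      refine pow_eq_zero_iff (two_ne_zero) |>.1 ?_
      linear_combination hd + hP'
    -- Differentiating φ² + 1 - Δ² = -φ_q ϑ_{q+1} at the edge, the open gap forces φ_q′ ≠ 0 and
    -- ϑ_{q+1} ≠ 0.
    have hder := congrArg (fun s => aeval P.1 (derivative s)) H₀.phiHalf_sq_add
    simp [derivative_sq, hhalf, hφ] at hder
    have hD := edgeDeriv_ne hgaps hP hΩ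
    have hprod : H₀.edgeDeriv P =
        -(aeval P.1 (derivative (H₀.phi q)) * aeval P.1 (H₀.theta (q + 1))) := by
      rw [edgeDeriv, disc]
      linear_combination -hder
    have hφ' : aeval P.1 (derivative (H₀.phi q)) ≠ 0 := fun h => hD (by rw [hprod, h]; simp)
    have hϑ : aeval P.1 (H₀.theta (q + 1)) ≠ 0 := fun h => hD (by rw [hprod, h]; simp)
    -- Here N = -ϑ_{q+1} (φ₀⁺)², so φ₀⁺ vanishes and its zero cancels the simple zero of φ_q in m₊.
    have hE : aeval P.1 (V.phiPlus H₀ p 0) = 0 := by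
      simp only [normPoly, map_sub, map_add, map_mul, map_pow, hφ, hhalf] at h0
      simpa [hϑ] using h0
    obtain ⟨e, he, -⟩ := exists_aeval_eq_sub_mul hE
    obtain ⟨r, hr, hr'⟩ := exists_aeval_eq_sub_mul hφ
    have heq : (fun t => V.jostPlus H₀ p 0 (H₀.chart P t)) =ᶠ[𝓝[≠] 0] fun t =>
        aeval (H₀.chart P t).1 (V.thetaPlus H₀ p 0) +
          (aeval (H₀.chart P t).1 H₀.phiHalf + Complex.I * (H₀.chart P t).2) *
            aeval (H₀.chart P t).1 e / aeval (H₀.chart P t).1 r := by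
      filter_upwards [eventually_aeval_chart_ne hgaps hP (phi_q_ne_zero hq)] with t ht
      rw [hV.jostPlus_eq, mPlus, he, hr]
      rw [hr] at ht
      have h1 := left_ne_zero_of_mul ht
      have h2 := right_ne_zero_of_mul ht
      field_simp
    rw [ordAt, meromorphicOrderAt_congr heq]
    refine AnalyticAt.meromorphicOrderAt_nonneg ((analyticAt_aeval_chart _).add
      (AnalyticAt.div (((analyticAt_aeval_chart _).add
        (analyticAt_const.mul (analyticAt_chart_snd hgaps hP))).mul
          (analyticAt_chart_fst.aeval_polynomial e)) (analyticAt_chart_fst.aeval_polynomial r) ?_))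
    rw [H₀.chart_zero hP, hr']
    exact hφ'
  -- Otherwise N = φ_q (f₀⁺)² at the edge. A zero of f₀⁺ would make Ω f₀⁺ vanish to order at least
  -- 2, while R₋ + 1 has order at most 1 and ŵ has no zero there.
  · have hf := hV.analyticAt_jostPlus hgaps hP hφ 0
    have hPn : ((P.1, -P.2) : ℂ × ℂ) = P := Prod.ext rfl (by simp [hΩ])
    rw [hV.aeval_normPoly_eq hP hφ, hPn, mul_assoc, mul_eq_zero, or_iff_right hφ,
      mul_self_eq_zero] at h0
    have hf0 : 0 < H₀.ordAt (V.jostPlus H₀ p 0) P :=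
      (meromorphicOrderAt_pos_iff_of_analyticAt hf).2 (by rw [H₀.chart_zero hP, h0])
    have e := hV.ordAt_refl_add hq hgaps hgen hP
    have hw : ¬ 0 < H₀.ordAt (V.wHat H₀ p) P := fun h =>
      Set.disjoint_left.1 hgen.wHat_edge ⟨hP, h⟩ ⟨hP, hΩ⟩
    have hR := ordAt_le_one hgen.simple_refl hP
    have h1 : ∀ o : WithTop ℤ, 0 < o → 1 ≤ o := fun o ho => by
      cases o with
      | top => exact le_top
      | coe n => norm_cast at ho ⊢
    have h2 : (1 : WithTop ℤ) + 1 ≤ 1 + 0 :=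
      ((add_le_add (h1 _ hpos) (h1 _ hf0)).trans_eq e.symm).trans (add_le_add hR (not_lt.1 hw))
    norm_cast at h2

/-- As Δ is not constant, Δ = 1 has a solution; it is a band edge, and N does not vanish there. -/
theorem InClass.normPoly_ne_zero (hV : V.InClass H₀ p ν) (hq : 2 ≤ q)
    (hgaps : H₀.AllGapsOpen) (hgen : V.Generic H₀ p) : V.normPoly H₀ p ≠ 0 := by
  intro h
  have hdeg : 0 < ((1 : ℝ[X]) - H₀.lyapunov).degree := by
    by_contra hdeg
    rw [not_lt] at hdeg
    have h1 : ∀ l : ℝ, aeval l H₀.lyapunov = 1 - ((1 : ℝ[X]) - H₀.lyapunov).coeff 0 := fun l => by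
      have := congrArg (aeval l) (eq_C_of_degree_le_zero hdeg)
      simp only [map_sub, map_one, aeval_C, Algebra.algebraMap_self, RingHom.id_apply] at this
      linear_combination -this
    have h2 : Tendsto (fun l : ℝ => aeval l H₀.lyapunov / l ^ q) atTop (𝓝 0) := by
      simp only [h1]
      exact tendsto_const_nhds.div_atTop (tendsto_pow_atTop (by omega))
    exact H₀.lead_pos.ne' (tendsto_nhds_unique (tendsto_lyapunov hq) h2)
  obtain ⟨z, hz⟩ := IsAlgClosed.exists_aeval_eq_zero ℂ _ hdeg.ne'
  have hz' : H₀.disc z = 1 := by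
    simp only [map_sub, map_one] at hz
    rw [disc]
    linear_combination -hz
  exact hV.aeval_normPoly_ne_zero hq hgaps hgen (P := (z, 0)) (by simp [surface, hz']) rfl
    (by rw [h, map_zero])

/-- Off the branch points λ is a local parameter on both sheets, so orders add in N = φ_q f₀⁺
(f₀⁺)*. -/
theorem InClass.rootMultiplicity_normPoly (hV : V.InClass H₀ p ν) (hq : 2 ≤ q)
    (hgaps : H₀.AllGapsOpen) (hgen : V.Generic H₀ p) (hP : P ∈ H₀.surface) (hΩ : P.2 ≠ 0) :
    ((((V.normPoly H₀ p).map (algebraMap ℝ ℂ)).rootMultiplicity P.1 : ℤ) : WithTop ℤ) =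
      meromorphicOrderAt (fun t => aeval (H₀.chart P t).1 (H₀.phi q)) 0 +
        H₀.ordAt (V.jostPlus H₀ p 0) P + H₀.ordAt (V.jostPlus H₀ p 0) (P.1, -P.2) := by
  rw [← meromorphicOrderAt_aeval (hV.normPoly_ne_zero hq hgaps hgen)]
  have h1 : MeromorphicAt (fun t => aeval (H₀.chart P t).1 (H₀.phi q)) 0 :=
    (analyticAt_aeval_chart _).meromorphicAt
  have h2 := hV.meromorphicAt_jostPlus hgaps hP 0
  have h3 := hV.meromorphicAt_jostPlus hgaps (surface_neg hP) 0
  unfold ordAt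
  rw [← fun_meromorphicOrderAt_mul h1 h2, ← fun_meromorphicOrderAt_mul (h1.fun_mul h2) h3]
  refine meromorphicOrderAt_congr ?_
  filter_upwards [eventually_aeval_chart_ne hgaps hP (phi_q_ne_zero hq)] with t ht
  rw [chart_neg hΩ, ← hV.aeval_normPoly_eq (H₀.chart_mem hP t) ht, chart_of_ne hΩ]

theorem normPoly_roots_eq {V' : Perturbation} {ν' : ℕ} (hV : V.InClass H₀ p ν)
    (hV' : V'.InClass H₀ p ν') (hq : 2 ≤ q) (hgaps : H₀.AllGapsOpen) (hgen : V.Generic H₀ p)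
    (hgen' : V'.Generic H₀ p)
    (hrefl : H₀.zeroSet (V.reflMinusAddOne H₀ p) = H₀.zeroSet (V'.reflMinusAddOne H₀ p))
    (hphi : V.phiPlus H₀ p 0 = V'.phiPlus H₀ p 0) :
    ((V.normPoly H₀ p).map (algebraMap ℝ ℂ)).roots =
      ((V'.normPoly H₀ p).map (algebraMap ℝ ℂ)).roots := by
  classical
  have key : ∀ P ∈ H₀.surface, P.2 ≠ 0 →
      H₀.ordAt (V.jostPlus H₀ p 0) P = H₀.ordAt (V'.jostPlus H₀ p 0) P := by
    intro P hP hΩ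
    by_cases hφ : aeval P.1 (H₀.phi q) = 0
    · rw [hV.ordAt_jostPlus_of_phi_eq hq hgaps hgen hP hΩ hφ,
        hV'.ordAt_jostPlus_of_phi_eq hq hgaps hgen' hP hΩ hφ, hphi]
    · rw [hV.ordAt_jostPlus_of_phi_ne hq hgaps hgen hP hΩ hφ,
        hV'.ordAt_jostPlus_of_phi_ne hq hgaps hgen' hP hΩ hφ, hrefl]
  ext z
  rw [count_roots, count_roots]
  obtain ⟨r, hr⟩ := IsAlgClosed.exists_pow_nat_eq (1 - H₀.disc z ^ 2) two_pos
  have hP : ((z, r) : ℂ × ℂ) ∈ H₀.surface := hr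
  by_cases h : r = 0
  · have e1 := hV.aeval_normPoly_ne_zero hq hgaps hgen hP h
    have e2 := hV'.aeval_normPoly_ne_zero hq hgaps hgen' hP h
    rw [rootMultiplicity_eq_zero, rootMultiplicity_eq_zero]
    · simpa [IsRoot.def, eval_map_algebraMap] using e2
    · simpa [IsRoot.def, eval_map_algebraMap] using e1
  · have e1 := hV.rootMultiplicity_normPoly hq hgaps hgen hP h
    have e2 := hV'.rootMultiplicity_normPoly hq hgaps hgen' hP h
    rw [key _ hP h, key _ (surface_neg hP) (by simpa using h), ← e2] at e1
    exact_mod_cast e1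

end Perturbation

/-! ### Reality of the zeros of the Lyapunov function -/

namespace PeriodicJacobi

variable {q : ℕ} {H₀ : PeriodicJacobi q}

/-- If Δ(z) = 0, the monodromy matrix has trace 0 and determinant 1, hence eigenvalue i. An
eigenvector gives a solution with (y_q, y_{q+1}) = i (y₀, y₁). Since |i| = 1, the Wronskian of y
with its conjugate returns to its value after a period, and Green's formula gives Im z · ∑ |y_n|² =
0. -/
theorem im_eq_zero_of_disc_eq_zero (hq : 2 ≤ q) {z : ℂ} (hz : H₀.disc z = 0) : z.im = 0 := by
  have hdet := congrArg (aeval z) H₀.det_monodromy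
  simp only [map_sub, map_mul, map_one] at hdet
  have htr : aeval z (H₀.phi (q + 1)) + aeval z (H₀.theta q) = 0 := by
    rw [disc, lyapunov, map_mul, map_add, mul_eq_zero, aeval_C] at hz
    exact hz.resolve_left (by simp)
  obtain ⟨c, hc, hmul⟩ := Matrix.exists_mulVec_eq_zero_iff (M :=
    !![aeval z (H₀.theta q) - Complex.I, aeval z (H₀.phi q);
      aeval z (H₀.theta (q + 1)), aeval z (H₀.phi (q + 1)) - Complex.I]).2 (by
        rw [Matrix.det_fin_two_of]
        linear_combination hdet - Complex.I * htr + Complex.I_sq)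
  have e0 := congrFun hmul 0
  have e1 := congrFun hmul 1
  simp [Matrix.mulVec, dotProduct, Fin.sum_univ_two] at e0 e1
  set y : ℤ → ℂ := fun n => c 0 * aeval z (H₀.theta n) + c 1 * aeval z (H₀.phi n) with hy
  have hs : IsSol H₀.a H₀.b z y := by
    simpa using ((H₀.isSol_theta.map (aeval z)).const_mul (c 0)).add_mul
      (H₀.isSol_phi.map (aeval z)) (c 1)
  have y0 : y 0 = c 0 := by simp [hy]
  have y1 : y 1 = c 1 := by simp [hy]
  have yq : y q = Complex.I * y 0 := by
    rw [y0]
    linear_combination e0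
  have yq1 : y (q + 1) = Complex.I * y 1 := by
    rw [y1]
    linear_combination e1
  by_contra him
  set W : ℕ → ℂ := fun n => H₀.a n * (y (n + 1) * (starRingEnd ℂ) (y n) -
    y n * (starRingEnd ℂ) (y (n + 1))) with hW
  have hstep : ∀ n : ℕ, W (n + 1) - W n =
      (z - (starRingEnd ℂ) z) * (Complex.normSq (y (n + 1 : ℕ)) : ℝ) := by
    intro n
    have h1 := hs (n + 1 : ℕ)
    have h2 := congrArg (starRingEnd ℂ) h1
    simp only [Complex.real_smul, map_add, map_mul, Complex.conj_ofReal] at h1 h2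
    rw [← Complex.mul_conj]
    simp only [hW]
    push_cast at h1 h2 ⊢
    rw [add_sub_cancel_right] at h1 h2
    linear_combination (starRingEnd ℂ) (y (n + 1)) * h1 - y (n + 1) * h2
  have hWq : W q = W 0 := by
    simp only [hW, Nat.cast_zero, zero_add]
    rw [yq, yq1, H₀.a_period, map_mul, map_mul, Complex.conj_I]
    linear_combination (H₀.a 0 * (y 0 * (starRingEnd ℂ) (y 1) -
      y 1 * (starRingEnd ℂ) (y 0)) : ℂ) * Complex.I_sq
  have hsum : (z - (starRingEnd ℂ) z) *
      ((∑ n ∈ Finset.range q, Complex.normSq (y (n + 1 : ℕ)) : ℝ) : ℂ) = 0 := by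
    rw [Complex.ofReal_sum, Finset.mul_sum, ← Finset.sum_congr rfl fun n _ => hstep n,
      Finset.sum_range_sub, hWq, sub_self]
  have hne : z - (starRingEnd ℂ) z ≠ 0 := by
    rw [Complex.sub_conj]
    simpa using him
  have hzero := (mul_eq_zero.1 hsum).resolve_left hne
  rw [Complex.ofReal_eq_zero, Finset.sum_eq_zero_iff_of_nonneg
    fun _ _ => Complex.normSq_nonneg _] at hzero
  have z1 : y 1 = 0 := by
    have := hzero 0 (by simp; omega)
    simpa using this
  have zq : y q = 0 := by
    have := hzero (q - 1) (by simp; omega)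
    rw [Nat.sub_add_cancel (by omega)] at this
    simpa using this
  rw [yq] at zq
  have z0 : y 0 = 0 := by simpa using zq
  refine hc (funext fun i => ?_)
  fin_cases i
  · simpa [y0] using z0
  · simpa [y1] using z1

/-- The bands have non-empty interior. -/
theorem infinite_band (hq : 2 ≤ q) : {l : ℝ | H₀.lyapunov.eval l ^ 2 < 1}.Infinite := by
  have hdeg : H₀.lyapunov.degree ≠ 0 := by
    intro hdeg
    have h1 : ∀ l : ℝ, aeval l H₀.lyapunov = H₀.lyapunov.coeff 0 := fun l => by
      have := congrArg (aeval l) (eq_C_of_degree_eq_zero hdeg)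
      simpa using this
    have h2 : Tendsto (fun l : ℝ => aeval l H₀.lyapunov / l ^ q) atTop (𝓝 0) := by
      simp only [h1]
      exact tendsto_const_nhds.div_atTop (tendsto_pow_atTop (by omega))
    exact H₀.lead_pos.ne' (tendsto_nhds_unique (tendsto_lyapunov hq) h2)
  obtain ⟨z, hz⟩ := IsAlgClosed.exists_aeval_eq_zero ℂ _ hdeg
  have him := im_eq_zero_of_disc_eq_zero (H₀ := H₀) hq hz
  have hzr : z = (z.re : ℂ) := Complex.ext rfl (by simp [him])
  have h0 : H₀.lyapunov.eval z.re = 0 := by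
    rw [hzr, ← Complex.coe_algebraMap, aeval_algebraMap_apply] at hz
    simpa using hz
  have hopen : IsOpen {l : ℝ | H₀.lyapunov.eval l ^ 2 < 1} :=
    isOpen_lt (by fun_prop) continuous_const
  exact infinite_of_mem_nhds z.re (hopen.mem_nhds (by simp [h0]))

end PeriodicJacobi

/-! ### Recovery of the odd part of ŵ from A. -/

namespace Perturbation

open PeriodicJacobi

variable {q : ℕ} {H₀ : PeriodicJacobi q} {p : ℕ} {V V' : Perturbation} {ν ν' : ℕ}

/-- On a band Ω is real, so in ŵ / (2iΩ) the even part contributes a purely imaginary number and the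
odd part a real one. -/
theorem InClass.eval_wOdd (hV : V.InClass H₀ p ν) {A : ℝ[X]} (hA : V.IsPolyA H₀ p A) {l : ℝ}
    (hl : H₀.lyapunov.eval l ^ 2 < 1) (hφ : (H₀.phi q).eval l ≠ 0) :
    (V.wOdd H₀ p).eval l = 2 * H₀.a 0 * (A.eval l + 1) := by
  set r := √(1 - H₀.lyapunov.eval l ^ 2) with hr
  have hr0 : r ≠ 0 := (Real.sqrt_pos.2 (by linarith)).ne'
  have hr2 : r ^ 2 = 1 - H₀.lyapunov.eval l ^ 2 := Real.sq_sqrt (by linarith)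
  have hev : ∀ s : ℝ[X], aeval (l : ℂ) s = ((s.eval l : ℝ) : ℂ) := fun s => by
    rw [← Complex.coe_algebraMap, aeval_algebraMap_apply]
    simp
  have hP : (((l : ℂ), (r : ℂ)) : ℂ × ℂ) ∈ H₀.surface := by
    change (r : ℂ) ^ 2 = 1 - H₀.disc l ^ 2
    rw [disc, hev]
    exact_mod_cast hr2
  have h := hA l hl _ hP rfl
  have hα : V.alpha H₀ p ((l : ℂ), (r : ℂ)) =
      (((V.wOdd H₀ p).eval l / (2 * H₀.a 0) : ℝ) : ℂ) -
        (((V.wEven H₀ p).eval l / (2 * H₀.a 0 * r) : ℝ) : ℂ) * Complex.I := by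
    rw [alpha, hV.wHat_eq hP (by simp only [hev]; exact_mod_cast hφ)]
    simp only [hev]
    have ha : (H₀.a 0 : ℂ) ≠ 0 := by exact_mod_cast H₀.a_ne 0
    have hr' : (r : ℂ) ≠ 0 := by exact_mod_cast hr0
    push_cast
    field_simp
    linear_combination ((eval l (V.wEven H₀ p) : ℝ) : ℂ) * Complex.I_sq
  rw [hα] at h
  have ha := H₀.a_ne 0
  rw [Complex.sub_re, Complex.ofReal_re, Complex.re_ofReal_mul, Complex.I_re, mul_zero,
    sub_zero] at h
  field_simp at h
  linear_combination -h

theorem wOdd_eq (hV : V.InClass H₀ p ν) (hV' : V'.InClass H₀ p ν') (hq : 2 ≤ q) {A : ℝ[X]}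
    (hA : V.IsPolyA H₀ p A) (hA' : V'.IsPolyA H₀ p A) : V.wOdd H₀ p = V'.wOdd H₀ p := by
  have hfin : {l : ℝ | (H₀.phi q).eval l = 0}.Finite := by
    refine ((H₀.phi q).rootSet_finite ℝ).subset fun l hl => ?_
    rw [mem_rootSet]
    exact ⟨phi_q_ne_zero hq, by simpa using hl⟩
  refine eq_of_infinite_eval_eq _ _ (((infinite_band (H₀ := H₀) hq).sdiff hfin).mono ?_)
  rintro l ⟨hl, hφ⟩
  exact (hV.eval_wOdd hA hl hφ).trans (hV'.eval_wOdd hA' hl hφ).symm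

/-! ### Consequences of the behaviour at infinity -/

theorem InClass.lead_ne (hV : V.InClass H₀ p ν) :
    -V.c₂ H₀ p ν / ∏ i ∈ Finset.range p, H₀.a (1 + i) ≠ 0 :=
  div_ne_zero (neg_ne_zero.2 hV.c₂_ne) (Finset.prod_ne_zero_iff.2 fun _ _ => H₀.a_ne _)

/-- The leading term of φ₀⁺ has degree ν - 1 and coefficient -c₂ / ∏ a⁰. Unequal degrees would force
one of these coefficients to vanish. -/
theorem c₂_eq (hV : V.InClass H₀ p ν) (hV' : V'.InClass H₀ p ν') (hp : 1 ≤ p)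
    (hphi : V.phiPlus H₀ p 0 = V'.phiPlus H₀ p 0) : V.c₂ H₀ p ν = V'.c₂ H₀ p ν' := by
  have h := hV.tendsto_phiPlus hp
  have h' := hV'.tendsto_phiPlus hp
  rw [hphi] at h
  rcases lt_trichotomy (ν - 1) (ν' - 1) with hlt | heq | hlt
  · exact absurd (tendsto_nhds_unique h' (tendsto_div_pow_of_lt h hlt)) hV'.lead_ne
  · rw [heq] at h
    have := tendsto_nhds_unique h h'
    rw [div_left_inj' (Finset.prod_ne_zero_iff.2 fun _ _ => H₀.a_ne _)] at this
    exact neg_injective this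
  · exact absurd (tendsto_nhds_unique h (tendsto_div_pow_of_lt h' hlt)) hV.lead_ne

theorem c₁_eq (hV : V.InClass H₀ p ν) (hV' : V'.InClass H₀ p ν') (hp : 1 ≤ p)
    (hphi : V.phiPlus H₀ p 0 = V'.phiPlus H₀ p 0) (hc₃ : V.c₃ H₀ p ν = V'.c₃ H₀ p ν') :
    V.c₁ H₀ p = V'.c₁ H₀ p := by
  rw [c₃, c₃, c₂_eq hV hV' hp hphi] at hc₃
  exact mul_right_cancel₀ hV'.c₂_ne hc₃

theorem InClass.eventually_phiPlus_ne (hV : V.InClass H₀ p ν) (hp : 1 ≤ p) :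
    ∀ᶠ l : ℝ in atTop, aeval l (V.phiPlus H₀ p 0) ≠ 0 := by
  filter_upwards [(hV.tendsto_phiPlus hp).eventually_ne hV.lead_ne] with l hl h0
  simp [h0] at hl

theorem InClass.tendsto_phi_div (hV : V.InClass H₀ p ν) (hq : 2 ≤ q) (hp : 1 ≤ p) :
    Tendsto (fun l : ℝ => aeval l (H₀.phi q) / (H₀.root l * aeval l (V.phiPlus H₀ p 0)))
      atTop (𝓝 0) := by
  have h1 : Tendsto (fun l : ℝ => aeval l (H₀.phi q) / l ^ (q + (ν - 1))) atTop (𝓝 0) := by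
    rcases Nat.eq_zero_or_pos (ν - 1) with h | h
    · rw [h]
      exact H₀.tendsto_phi_div_pow q
    · exact tendsto_div_pow_of_lt (H₀.tendsto_phi_div_pow q) (by omega)
  have h := h1.div ((tendsto_root (H₀ := H₀) hq).mul (hV.tendsto_phiPlus hp))
    (mul_ne_zero H₀.lead_pos.ne' hV.lead_ne)
  rw [zero_div] at h
  refine h.congr' ?_
  filter_upwards [eventually_gt_atTop 0] with l hl
  simp only [Pi.div_apply, pow_add]
  rw [div_mul_div_comm, div_div_div_cancel_right₀ (by positivity)]

/-- With r = √(Δ² - 1), φ_q (f₀⁺)* = φ_q f₀⁺ + 2r φ₀⁺, so N = f₀⁺ (φ_q f₀⁺ + 2r φ₀⁺). The second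
term dominates, as f₀⁺ is bounded and φ_q / (r φ₀⁺) → 0. -/
theorem InClass.tendsto_normPoly (hV : V.InClass H₀ p ν) (hq : 2 ≤ q) (hp : 1 ≤ p) :
    Tendsto (fun l : ℝ => aeval l (V.normPoly H₀ p) /
        (H₀.root l * aeval l (V.phiPlus H₀ p 0))) atTop
      (𝓝 (2 * (V.c₁ H₀ p * ∏ i ∈ Finset.range (p + 1), H₀.a i))) := by
  have hf := hV.tendsto_jostReal hq
  have h := hf.mul (((hV.tendsto_phi_div hq hp).mul hf).add_const 2)
  rw [zero_mul, zero_add, mul_comm] at h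
  refine h.congr' ?_
  filter_upwards [hV.eventually_phiPlus_ne hp, eventually_root_pos hq, eventually_phi_ne hq]
    with l hE hR hφ
  rw [aeval_normPoly (root_sq hR) hφ, jostReal, weyl]
  field_simp
  ring

/-! ### Reconstruction of N and of ϑ₀⁺. -/

theorem normPoly_eq (hV : V.InClass H₀ p ν) (hV' : V'.InClass H₀ p ν') (hq : 2 ≤ q) (hp : 1 ≤ p)
    (hphi : V.phiPlus H₀ p 0 = V'.phiPlus H₀ p 0) (hc : V.c₁ H₀ p = V'.c₁ H₀ p)
    (hroots : ((V.normPoly H₀ p).map (algebraMap ℝ ℂ)).roots =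
      ((V'.normPoly H₀ p).map (algebraMap ℝ ℂ)).roots) :
    V.normPoly H₀ p = V'.normPoly H₀ p := by
  set D := V.normPoly H₀ p with hD
  set D' := V'.normPoly H₀ p with hD'
  have h1 := (IsAlgClosed.splits (D.map (algebraMap ℝ ℂ))).eq_prod_roots
  have h2 := (IsAlgClosed.splits (D'.map (algebraMap ℝ ℂ))).eq_prod_roots
  rw [leadingCoeff_map] at h1 h2
  have h3 : C D'.leadingCoeff * D = C D.leadingCoeff * D' := by
    refine map_injective _ (algebraMap ℝ ℂ).injective ?_
    rw [Polynomial.map_mul, Polynomial.map_mul, map_C, map_C, h1, h2, hroots]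
    ring
  have t1 := (hV.tendsto_normPoly hq hp).const_mul D'.leadingCoeff
  have t2 := (hV'.tendsto_normPoly hq hp).const_mul D.leadingCoeff
  have ht := tendsto_nhds_unique t1 (t2.congr fun l => by
    have := congrArg (aeval l) h3
    simp only [map_mul, aeval_C, Algebra.algebraMap_self, RingHom.id_apply] at this
    rw [← mul_div_assoc, ← mul_div_assoc, hphi, ← this])
  have hlim : 2 * (V'.c₁ H₀ p * ∏ i ∈ Finset.range (p + 1), H₀.a i) ≠ 0 :=
    mul_ne_zero two_ne_zero (mul_ne_zero hV'.c₁_pos.ne'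
      (Finset.prod_ne_zero_iff.2 fun _ _ => H₀.a_ne _))
  rw [hc] at ht
  have hlead := mul_right_cancel₀ hlim ht
  rcases eq_or_ne D 0 with h0 | h0
  · rw [h0, leadingCoeff_zero, leadingCoeff_eq_zero] at hlead
    rw [h0, hlead]
  · rw [hlead] at h3
    exact mul_left_cancel₀ (by simpa using h0) h3

/-- The bracket is the even part of φ_q f₀⁺, whose odd part is iΩ φ₀⁺; the product with the
conjugate is a sum of squares. -/
theorem phi_mul_normPoly : H₀.phi q * V.normPoly H₀ p =
    (H₀.phi q * V.thetaPlus H₀ p 0 + H₀.phiHalf * V.phiPlus H₀ p 0) ^ 2 +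
      (1 - H₀.lyapunov ^ 2) * V.phiPlus H₀ p 0 ^ 2 := by
  rw [normPoly]
  linear_combination -(V.phiPlus H₀ p 0) ^ 2 * H₀.phiHalf_sq_add

/-- `ϑ⁺₀` is determined by `φ⁺₀` and `normPoly`. These fix the square of the part of `φ_q f₀⁺` which
is even under the exchange of sheets; its sign follows from the boundedness of `f₀⁺` at infinity. -/
theorem thetaPlus_eq (hV : V.InClass H₀ p ν) (hV' : V'.InClass H₀ p ν') (hq : 2 ≤ q) (hp : 1 ≤ p)
    (hphi : V.phiPlus H₀ p 0 = V'.phiPlus H₀ p 0)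
    (hnorm : V.normPoly H₀ p = V'.normPoly H₀ p) :
    V.thetaPlus H₀ p 0 = V'.thetaPlus H₀ p 0 := by
  have h1 := phi_mul_normPoly (H₀ := H₀) (p := p) (V := V)
  have h2 := phi_mul_normPoly (H₀ := H₀) (p := p) (V := V')
  rw [hnorm, h2, hphi] at h1
  rcases sq_eq_sq_iff_eq_or_eq_neg.1 (add_right_cancel h1) with h | h
  · exact (mul_left_cancel₀ (phi_q_ne_zero hq) (add_right_cancel h)).symm
  -- With opposite even parts, φ_q times the sum of the two Jost functions is -2√(Δ² - 1) φ₀⁺, too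
  -- large for bounded Jost functions.
  · exfalso
    have ht := (hV.tendsto_phi_div hq hp).mul
      ((hV.tendsto_jostReal hq).add (hV'.tendsto_jostReal hq))
    rw [zero_mul] at ht
    have : Tendsto (fun _ : ℝ => (-2 : ℝ)) atTop (𝓝 0) := by
      refine ht.congr' ?_
      filter_upwards [hV.eventually_phiPlus_ne hp, eventually_root_pos hq, eventually_phi_ne hq]
        with l hE hR hφ
      have e := congrArg (aeval l) h
      simp only [map_add, map_mul, map_neg] at e
      rw [jostReal, jostReal, weyl, ← hphi]
      rw [← hphi] at e
      field_simp
      linear_combination e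
    exact absurd (tendsto_nhds_unique tendsto_const_nhds this) (by norm_num)

end Perturbation

end JacobiScattering

end

/-! ### Assembly. -/

open JacobiScattering Perturbation in
theorem theorem1p3 {q p : ℕ} (hq : 2 ≤ q) (hp : 1 ≤ p)
    (H₀ : JacobiScattering.PeriodicJacobi q) (hgaps : H₀.AllGapsOpen)
    (V V' : JacobiScattering.Perturbation) (ν ν' : ℕ)
    (hV : V.InClass H₀ p ν) (hV' : V'.InClass H₀ p ν')
    (hgen : V.Generic H₀ p) (hgen' : V'.Generic H₀ p)
    (hbound : V.boundStates H₀ p = V'.boundStates H₀ p)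
    (hres : V.resonances H₀ p = V'.resonances H₀ p)
    (hrefl : H₀.zeroSet (V.reflMinusAddOne H₀ p) = H₀.zeroSet (V'.reflMinusAddOne H₀ p))
    (A : Polynomial ℝ) (hA : V.IsPolyA H₀ p A) (hA' : V'.IsPolyA H₀ p A)
    (hphi : V.phiPlus H₀ p 0 = V'.phiPlus H₀ p 0)
    (hc₃ : V.c₃ H₀ p ν = V'.c₃ H₀ p ν') (hv₀ : V.v 0 = V'.v 0) :
    ∀ P ∈ H₀.surface, P ∉ H₀.dirichletPoints →
      V.wHat H₀ p P = V'.wHat H₀ p P ∧ V.jostPlus H₀ p 0 P = V'.jostPlus H₀ p 0 P := by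
  intro P hP hPD
  have hφ : Polynomial.aeval P.1 (H₀.phi q) ≠ 0 := fun h => hPD ⟨hP, h⟩
  have hnorm := normPoly_eq hV hV' hq hp hphi (c₁_eq hV hV' hp hphi hc₃)
    (normPoly_roots_eq hV hV' hq hgaps hgen hgen' hrefl hphi)
  have hϑ := thetaPlus_eq hV hV' hq hp hphi hnorm
  have hodd := wOdd_eq hV hV' hq hA hA'
  have hφ1 : Polynomial.C (V.a H₀ 0) * V.phiPlus H₀ p 1 =
      Polynomial.C (V'.a H₀ 0) * V'.phiPlus H₀ p 1 := by
    rw [wOdd, wOdd, hϑ, hphi, hv₀] at hodd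
    exact add_right_cancel (add_right_cancel hodd)
  have hne : V'.phiPlus H₀ p 0 ≠ 0 := fun h => by
    obtain ⟨l, hl⟩ := (hV'.eventually_phiPlus_ne hp).exists
    simp [h] at hl
  have hϑ1 : Polynomial.C (V.a H₀ 0) * V.thetaPlus H₀ p 1 =
      Polynomial.C (V'.a H₀ 0) * V'.thetaPlus H₀ p 1 := by
    have h := hV.wronskian_plus
    have h' := hV'.wronskian_plus
    rw [hϑ, hphi] at h
    -- The Wronskian determines a₀ ϑ₁⁺ φ₀⁺, and φ₀⁺ is a non-zero polynomial.
    refine mul_right_cancel₀ hne ?_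
    linear_combination h' - h + V'.thetaPlus H₀ p 0 * hφ1
  have heven : V.wEven H₀ p = V'.wEven H₀ p := by
    rw [wEven, wEven, hϑ, hphi, hv₀]
    linear_combination H₀.phi q * hϑ1 + H₀.phiHalf * hφ1
  exact ⟨by rw [hV.wHat_eq hP hφ, hV'.wHat_eq hP hφ, heven, hodd],
    by rw [hV.jostPlus_eq, hV'.jostPlus_eq, hϑ, hphi]⟩
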